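/- **Setting.** Let $T>0$ and $n,m\ge 0$ be integers. Let $A:[0,T]\times\mathbb{R}^n\to\mathbb{R}^n$, $B:[0,T]\times\mathbb{R}^n\to\mathbb{R}^{n\times m}$, $Q:[0,T]\times\mathbb{R}^n\to\mathbb{R}$, $S:[0,T]\times\mathbb{R}^n\to\mathbb{R}^m$, $R:[0,T]\times\mathbb{R}^n\to\mathbb{S}^m$ (the symmetric $m\times m$ matrices) and $G:\mathbb{R}^n\to\mathbb{R}$. For $t\in[0,T]$ the admissible controls on $[t,T]$ are the $u\in L^2(t,T;\mathbb{R}^m)$. For $x\in\mathbb{R}^n$ and an admissible $u$ let $X(\cdot)=X(\cdot\,;t,x,u)$ be the (Carathéodory) solution of $$\dot X(s)=A(s,X(s))+B(s,X(s))u(s),\quad s\in[t,T],\qquad X(t)=x,$$ and put $$J(t,x;u)=\int_t^T\Big[Q(s,X(s))+\langle S(s,X(s)),u(s)\rangle+\tfrac12\langle R(s,X(s))u(s),u(s)\rangle\Big]ds+G(X(T)),\qquad V(t,x)=\inf_{u}J(t,x;u).$$ A pair $(X^*,u^*)$ is an optimal pair for $(t,x)$ if $u^*$ is admissible on $[t,T]$,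 $X^*=X(\cdot\,;t,x,u^*)$ and $J(t,x;u^*)=V(t,x)$. **Hypotheses.** (H1) $A$ and $B$ are continuous, and there are constants $L_A,L_B,\tilde L_B>0$ such that for all $t\in[0,T]$, $x,\bar x\in\mathbb{R}^n$, $u\in\mathbb{R}^m$: $|A(t,x)-A(t,\bar x)|\le L_A|x-\bar x|$, $|B(t,x)-B(t,\bar x)|\le\tilde L_B|x-\bar x|$ and $\langle[B(t,x)-B(t,\bar x)]^T(x-\bar x),u\rangle\le L_B|x-\bar x|^2$. (H2) $Q,S,R,G$ are continuous, and there are constants $L,Q_0,G_0,S_0>0$, $\varepsilon_0\in(0,1)$, $\rho_0>0$ and a continuous function $\rho:\mathbb{R}^n\to[\rho_0,\infty)$ such that for all $(t,x)\in[0,T]\times\mathbb{R}^n$: $R(t,x)\ge\rho(x)I$; $(1-\varepsilon_0)Q(t,x)-\frac12S(t,x)^TR(t,x)^{-1}S(t,x)\ge-L$ and $G(x)\ge-L$; $Q(t,x)\le Q_0(1+|x|^2)$, $G(x)\le G_0(1+|x|^2)$, $|S(t,x)|\le S_0(1+|x|)$; $|A(t,x)+B(t,x)R(t,x)^{-1}S(t,x)|\le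 L(1+|x|)$ and $|B(t,x)R(t,x)^{-1}B(t,x)^T|\le L$. (H3) $A,B,Q,S,R$ are twice continuously differentiable on $[0,T]\times\mathbb{R}^n$ (one-sided in time at $0$ and $T$), and $G$ is twice continuously differentiable on $\mathbb{R}^n$. **Proposition 6.1.** Assume (H1)–(H3), and that $B(t,x)=B(t)$ and $R(t,x)=R(t)$ do not depend on $x$. Suppose that the value function $V$ is twice (Fréchet) differentiable on $[0,T]\times\mathbb{R}^n$ (one-sided in time at $0$ and $T$). Then $P:=V_x^T$ is a solution of the quasi-Riccati equation: $P$ is differentiable on $[0,T]\times\mathbb{R}^n$ (one-sided in time at $0$ and $T$), and $$\begin{cases}P_t(t,x)+P_x(t,x)A(t,x)+A_x(t,x)^TP(t,x)+Q_x(t,x)^T\\ \quad-\,[P_x(t,x)B(t)+S_x(t,x)^T]R(t)^{-1}[B(t)^TP(t,x)+S(t,x)]=0,&(t,x)\in[0,T]\times\mathbb{R}^n,\\ P(T,x)=G_x(x)^T,&x\in\mathbb{R}^n.\end{cases}$$ Moreover, for every $(t,x)\in[0,T]\times\mathbb{R}^n$ and every optimal pair $(X^*,u^*)$ for $(t,x)$,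 the optimal control has the state feedback representation $$u^*(s)=-R(s)^{-1}\big[B(s)^TP(s,X^*(s))+S(s,X^*(s))\big]\qquad\text{for a.e. } s\in[t,T].$$ -/

import Mathlib

open MeasureTheory Set

noncomputable section

/-- The Euclidean space `ℝᵏ`. -/
abbrev Euc (k : ℕ) := EuclideanSpace ℝ (Fin k)

/-- The data of a deterministic affine quadratic optimal control problem on `[0, T]` with state
space `ℝⁿ` and control set `ℝᵐ`. Matrices are represented by the linear maps between Euclidean
spaces that they define (so that the transpose is the adjoint and `|·|` is the operator norm).
Only the values for times in `[0, T]` matter. -/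
structure AQProblem (n m : ℕ) where
  /-- the time horizon -/
  T : ℝ
  T_pos : 0 < T
  /-- the drift -/
  A : ℝ → Euc n → Euc n
  /-- the control coefficient, an `n × m` matrix -/
  B : ℝ → Euc n → (Euc m →L[ℝ] Euc n)
  /-- the running cost that does not involve the control -/
  Q : ℝ → Euc n → ℝ
  /-- the coefficient of the part of the running cost that is linear in the control -/
  S : ℝ → Euc n → Euc m
  /-- the weight of the quadratic part of the running cost, an `m × m` matrix -/
  R : ℝ → Euc n → (Euc m →L[ℝ] Euc m)
  /-- the terminal cost -/
  G : Euc n → ℝ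

namespace AQProblem

variable {n m : ℕ} (D : AQProblem n m)

/-- The domain `[0, T] × ℝⁿ`. -/
def dom : Set (ℝ × Euc n) := Icc 0 D.T ×ˢ univ

/-- Hypothesis (H1), for the control set `U = ℝᵐ`. -/
def H1 : Prop :=
  ContinuousOn (fun p : ℝ × Euc n => D.A p.1 p.2) D.dom ∧
  ContinuousOn (fun p : ℝ × Euc n => D.B p.1 p.2) D.dom ∧
  ∃ LA LB LB' : ℝ, 0 < LA ∧ 0 < LB ∧ 0 < LB' ∧
    (∀ t ∈ Icc 0 D.T, ∀ x y : Euc n, ‖D.A t x - D.A t y‖ ≤ LA * ‖x - y‖) ∧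
    (∀ t ∈ Icc 0 D.T, ∀ x y : Euc n, ‖D.B t x - D.B t y‖ ≤ LB' * ‖x - y‖) ∧
    (∀ t ∈ Icc 0 D.T, ∀ (u : Euc m) (x y : Euc n),
      inner ℝ (ContinuousLinearMap.adjoint (D.B t x - D.B t y) (x - y)) u ≤ LB * ‖x - y‖ ^ 2)

/-- Hypothesis (H2). The condition `R(t, x) ≥ ρ(x) I` is the inequality of quadratic forms. -/
def H2 : Prop :=
  ContinuousOn (fun p : ℝ × Euc n => D.Q p.1 p.2) D.dom ∧
  ContinuousOn (fun p : ℝ × Euc n => D.S p.1 p.2) D.dom ∧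
  ContinuousOn (fun p : ℝ × Euc n => D.R p.1 p.2) D.dom ∧
  Continuous D.G ∧
  (∀ t ∈ Icc 0 D.T, ∀ x : Euc n, IsSelfAdjoint (D.R t x)) ∧
  ∃ (L Q₀ G₀ S₀ ε₀ ρ₀ : ℝ) (ρ : Euc n → ℝ),
    0 < L ∧ 0 < Q₀ ∧ 0 < G₀ ∧ 0 < S₀ ∧ 0 < ε₀ ∧ ε₀ < 1 ∧ 0 < ρ₀ ∧
    Continuous ρ ∧ (∀ x, ρ₀ ≤ ρ x) ∧
    (∀ x, -L ≤ D.G x) ∧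
    (∀ x, D.G x ≤ G₀ * (1 + ‖x‖ ^ 2)) ∧
    ∀ t ∈ Icc 0 D.T, ∀ x : Euc n,
      (∀ u : Euc m, ρ x * ‖u‖ ^ 2 ≤ inner ℝ (D.R t x u) u) ∧
      -L ≤ (1 - ε₀) * D.Q t x - 1 / 2 * inner ℝ (D.S t x) ((D.R t x).inverse (D.S t x)) ∧
      D.Q t x ≤ Q₀ * (1 + ‖x‖ ^ 2) ∧
      ‖D.S t x‖ ≤ S₀ * (1 + ‖x‖) ∧
      ‖D.A t x + D.B t x ((D.R t x).inverse (D.S t x))‖ ≤ L * (1 + ‖x‖) ∧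
      ‖D.B t x ∘L (D.R t x).inverse ∘L ContinuousLinearMap.adjoint (D.B t x)‖ ≤ L

/-- Hypothesis (H3): the coefficients are twice continuously differentiable
(up to the boundary times `0` and `T`). -/
def H3 : Prop :=
  ContDiffOn ℝ 2 (fun p : ℝ × Euc n => D.A p.1 p.2) D.dom ∧
  ContDiffOn ℝ 2 (fun p : ℝ × Euc n => D.B p.1 p.2) D.dom ∧
  ContDiffOn ℝ 2 (fun p : ℝ × Euc n => D.Q p.1 p.2) D.dom ∧
  ContDiffOn ℝ 2 (fun p : ℝ × Euc n => D.S p.1 p.2) D.dom ∧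
  ContDiffOn ℝ 2 (fun p : ℝ × Euc n => D.R p.1 p.2) D.dom ∧
  ContDiff ℝ 2 D.G

/-- Admissible controls on `[t, T]`: square integrable functions with values in `ℝᵐ`. -/
def IsAdmissible (t : ℝ) (u : ℝ → Euc m) : Prop :=
  MemLp u 2 (volume.restrict (Icc t D.T))

/-- `X` solves `Ẋ(s) = A(s, X(s)) + B(s, X(s)) u(s)` on `[t, T]`, `X(t) = x`, in the sense of
Carathéodory, i.e. the integrated equation holds. -/
def IsTrajectory (t : ℝ) (x : Euc n) (u : ℝ → Euc m) (X : ℝ → Euc n) : Prop :=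
  ContinuousOn X (Icc t D.T) ∧
  IntegrableOn (fun r => D.A r (X r) + D.B r (X r) (u r)) (Icc t D.T) ∧
  ∀ s ∈ Icc t D.T, X s = x + ∫ r in t..s, (D.A r (X r) + D.B r (X r) (u r))

/-- `u` is an admissible control on `[t, T]` and `X` is the trajectory that starts from `(t, x)`
under `u`. -/
def IsAdmissiblePair (t : ℝ) (x : Euc n) (X : ℝ → Euc n) (u : ℝ → Euc m) : Prop :=
  D.IsAdmissible t u ∧ D.IsTrajectory t x u X

/-- The cost `J(t, x; u)` of the control `u` with trajectory `X` on `[t, T]`. -/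
def cost (t : ℝ) (X : ℝ → Euc n) (u : ℝ → Euc m) : ℝ :=
  (∫ s in t..D.T, (D.Q s (X s) + inner ℝ (D.S s (X s)) (u s)
      + 1 / 2 * inner ℝ (D.R s (X s) (u s)) (u s)))
    + D.G (X D.T)

/-- The value function `V(t, x)`: the infimum of the cost over all admissible controls on
`[t, T]` (each with its trajectory from `(t, x)`). -/
def value (t : ℝ) (x : Euc n) : ℝ :=
  sInf {c : ℝ | ∃ (X : ℝ → Euc n) (u : ℝ → Euc m), D.IsAdmissiblePair t x X u ∧ c = D.cost t X u}

/-- `(X, u)` is an optimal pair for the initial pair `(t, x)`. -/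
def IsOptimalPair (t : ℝ) (x : Euc n) (X : ℝ → Euc n) (u : ℝ → Euc m) : Prop :=
  D.IsAdmissiblePair t x X u ∧ D.cost t X u = D.value t x

/-- A real function of time and state is twice (Fréchet) differentiable on `[0, T] × ℝⁿ`
(one-sided in time at the times `0` and `T`). -/
def TwiceDifferentiable (W : ℝ → Euc n → ℝ) : Prop :=
  DifferentiableOn ℝ (fun p : ℝ × Euc n => W p.1 p.2) D.dom ∧
  DifferentiableOn ℝ (fderivWithin ℝ (fun p : ℝ × Euc n => W p.1 p.2) D.dom) D.dom

/-- The (classical) solutions `P : [0, T] × ℝⁿ → ℝⁿ` of the quasi-Riccati equation of the problem,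
when the control coefficient `B₀` and the weight `R₀` depend on time only:
`P_t + P_x A + A_xᵀ P + Q_xᵀ - (P_x B₀ + S_xᵀ) R₀⁻¹ (B₀ᵀ P + S) = 0` on `[0, T] × ℝⁿ` and
`P(T, ·) = G_xᵀ`. The time derivative is one-sided at the times `0` and `T`. -/
def SolvesQuasiRiccati (B₀ : ℝ → (Euc m →L[ℝ] Euc n)) (R₀ : ℝ → (Euc m →L[ℝ] Euc m))
    (P : ℝ → Euc n → Euc n) : Prop :=
  DifferentiableOn ℝ (fun p : ℝ × Euc n => P p.1 p.2) D.dom ∧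
  (∀ t ∈ Icc 0 D.T, ∀ x : Euc n,
    derivWithin (fun s => P s x) (Icc 0 D.T) t
      + fderiv ℝ (P t) x (D.A t x)
      + ContinuousLinearMap.adjoint (fderiv ℝ (D.A t) x) (P t x)
      + gradient (D.Q t) x
      - (fderiv ℝ (P t) x ∘L B₀ t + ContinuousLinearMap.adjoint (fderiv ℝ (D.S t) x))
          ((R₀ t).inverse (ContinuousLinearMap.adjoint (B₀ t) (P t x) + D.S t x)) = 0) ∧
  ∀ x : Euc n, P D.T x = gradient D.G x

end AQProblem

end

/-!
The dynamic programming principle says that `s ↦ V(s, X(s)) + (cost spent up to s)` is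
nondecreasing along every admissible path. By the chain rule its derivative is
`V_t + ⟨V_x, A + B u⟩ + Q + ⟨S, u⟩ + ½ ⟨R u, u⟩`, so this expression is nonnegative, and paths that
are optimal up to a small error show that its minimum over `u`, attained at the feedback control
`-R⁻¹ (Bᵀ V_xᵀ + S)`, is zero. Along an optimal pair it vanishes almost everywhere, which identifies
the control. For the quasi-Riccati equation, freeze `u` at the feedback control of `(t, x)`: as a
function of the state the expression is then nonnegative and vanishes at `x`, so its derivative at
`x` is zero. This derivative is the left-hand side of the equation, by the symmetry of the second
derivative of `V`.
-/

section Piecewise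

variable {F : Type*} [NormedAddCommGroup F] {g h : ℝ → F} {a b c : ℝ}

theorem intervalIntegrable_piecewise_Iic (hab : a ≤ b) (hbc : b ≤ c)
    (hg : IntervalIntegrable g volume a b) (hh : IntervalIntegrable h volume b c) :
    IntervalIntegrable ((Iic b).piecewise g h) volume a c := by
  refine (hg.congr fun r hr => ?_).trans (hh.congr fun r hr => ?_)
  · rw [uIoc_of_le hab] at hr
    exact (piecewise_eq_of_mem (Iic b) _ _ hr.2).symm
  · rw [uIoc_of_le hbc] at hr
    exact (piecewise_eq_of_notMem (Iic b) _ _ (not_le.2 hr.1)).symm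

theorem memLp_piecewise_Iic {p : ENNReal} (hg : MemLp g p (volume.restrict (Icc a b)))
    (hh : MemLp h p (volume.restrict (Icc b c))) :
    MemLp ((Iic b).piecewise g h) p (volume.restrict (Icc a c)) := by
  refine MemLp.piecewise measurableSet_Iic ?_ ?_
  · rw [Measure.restrict_restrict measurableSet_Iic]
    have hsub : Iic b ∩ Icc a c ⊆ Icc a b := fun s hs => ⟨hs.2.1, hs.1⟩
    exact hg.mono_measure (Measure.restrict_mono hsub le_rfl)
  · rw [Measure.restrict_restrict measurableSet_Iic.compl]
    have hsub : (Iic b)ᶜ ∩ Icc a c ⊆ Icc b c := fun s hs =>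
      ⟨(not_le.1 (mt mem_Iic.2 hs.1)).le, hs.2.2⟩
    exact hh.mono_measure (Measure.restrict_mono hsub le_rfl)

variable [NormedSpace ℝ F]

theorem integral_piecewise_Iic_of_le (hac : a ≤ c) (hcb : c ≤ b) :
    ∫ r in a..c, (Iic b).piecewise g h r = ∫ r in a..c, g r := by
  refine intervalIntegral.integral_congr fun r hr => ?_
  rw [uIcc_of_le hac] at hr
  exact piecewise_eq_of_mem (Iic b) _ _ (hr.2.trans hcb)

theorem integral_piecewise_Iic (hab : a ≤ b) (hbc : b ≤ c)
    (hg : IntervalIntegrable g volume a b) (hh : IntervalIntegrable h volume b c) :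
    ∫ r in a..c, (Iic b).piecewise g h r = (∫ r in a..b, g r) + ∫ r in b..c, h r := by
  have hi := intervalIntegrable_piecewise_Iic hab hbc hg hh
  have hb : b ∈ uIcc a c := by rw [uIcc_of_le (hab.trans hbc)]; exact ⟨hab, hbc⟩
  rw [← intervalIntegral.integral_add_adjacent_intervals
    (hi.mono_set (uIcc_subset_uIcc_left hb)) (hi.mono_set (uIcc_subset_uIcc_right hb)),
    integral_piecewise_Iic_of_le hab le_rfl]
  congr 1
  exact intervalIntegral.integral_congr_Ioo_of_le hbc fun r hr =>
    piecewise_eq_of_notMem (Iic b) _ _ (not_le.2 hr.1)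

end Piecewise

/-- `X` solves the differential equation `Ẋ(s) = f(s, X(s))` on `[a, b]` with `X(a) = x` in the
sense of Carathéodory: `s ↦ f(s, X(s))` is integrable and the integrated equation holds. -/
structure IsCaratheodorySolution {E : Type*} [NormedAddCommGroup E] [NormedSpace ℝ E]
    (f : ℝ → E → E) (a b : ℝ) (x : E) (X : ℝ → E) : Prop where
  le : a ≤ b
  intervalIntegrable : IntervalIntegrable (fun s => f s (X s)) volume a b
  eq_add_integral : ∀ s ∈ Icc a b, X s = x + ∫ r in a..s, f r (X r)

namespace IsCaratheodorySolution

variable {E : Type*} [NormedAddCommGroup E] [NormedSpace ℝ E]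
  {f g : ℝ → E → E} {a b c d : ℝ} {x : E} {X Y : ℝ → E}

theorem apply_left (h : IsCaratheodorySolution f a b x X) : X a = x := by
  simpa using h.eq_add_integral a (left_mem_Icc.2 h.le)

theorem intervalIntegrable_of_mem (h : IsCaratheodorySolution f a b x X) (hc : c ∈ Icc a b)
    (hd : d ∈ Icc a b) : IntervalIntegrable (fun s => f s (X s)) volume c d :=
  h.intervalIntegrable.mono_set <| by
    rw [← uIcc_of_le h.le] at hc hd
    exact uIcc_subset_uIcc hc hd

theorem continuousOn (h : IsCaratheodorySolution f a b x X) : ContinuousOn X (Icc a b) := by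
  have hc := intervalIntegral.continuousOn_primitive_interval' h.intervalIntegrable left_mem_uIcc
  rw [uIcc_of_le h.le] at hc
  exact (hc.const_add x).congr h.eq_add_integral

theorem sub_eq_integral (h : IsCaratheodorySolution f a b x X) (hc : c ∈ Icc a b)
    (hd : d ∈ Icc a b) : X d - X c = ∫ r in c..d, f r (X r) := by
  have ha := left_mem_Icc.2 h.le
  rw [h.eq_add_integral d hd, h.eq_add_integral c hc, add_sub_add_left_eq_sub,
    intervalIntegral.integral_interval_sub_left (h.intervalIntegrable_of_mem ha hd)
      (h.intervalIntegrable_of_mem ha hc)]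

theorem subinterval (h : IsCaratheodorySolution f a b x X) (hac : a ≤ c) (hcd : c ≤ d)
    (hdb : d ≤ b) : IsCaratheodorySolution f c d (X c) X where
  le := hcd
  intervalIntegrable :=
    h.intervalIntegrable_of_mem ⟨hac, hcd.trans hdb⟩ ⟨hac.trans hcd, hdb⟩
  eq_add_integral s hs := by
    rw [← h.sub_eq_integral ⟨hac, hcd.trans hdb⟩ ⟨hac.trans hs.1, hs.2.trans hdb⟩,
      add_sub_cancel]

theorem ae_hasDerivAt [CompleteSpace E] (h : IsCaratheodorySolution f a b x X) :
    ∀ᵐ s, s ∈ Ioo a b → HasDerivAt X (f s (X s)) s := by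
  filter_upwards [h.intervalIntegrable.ae_hasDerivAt_integral] with s hs hsab
  rw [uIcc_of_le h.le] at hs
  have hd := hs (Ioo_subset_Icc_self hsab) a (left_mem_Icc.2 h.le)
  refine (hd.const_add x).congr_of_eventuallyEq ?_
  filter_upwards [Icc_mem_nhds hsab.1 hsab.2] with r hr using h.eq_add_integral r hr

theorem piecewise (hX : IsCaratheodorySolution f a b x X)
    (hY : IsCaratheodorySolution g b c (X b) Y) :
    IsCaratheodorySolution ((Iic b).piecewise f g) a c x ((Iic b).piecewise X Y) := by
  have hfield : (fun s => (Iic b).piecewise f g s ((Iic b).piecewise X Y s)) =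
      (Iic b).piecewise (fun s => f s (X s)) (fun s => g s (Y s)) := by
    ext s
    by_cases hs : s ∈ Iic b <;> simp [hs]
  refine ⟨hX.le.trans hY.le, ?_, fun s hs => ?_⟩
  · rw [hfield]
    exact intervalIntegrable_piecewise_Iic hX.le hY.le hX.intervalIntegrable hY.intervalIntegrable
  · rw [hfield]
    rcases le_or_gt s b with hsb | hbs
    · rw [integral_piecewise_Iic_of_le hs.1 hsb, piecewise_eq_of_mem (Iic b) _ _ hsb,
        hX.eq_add_integral s ⟨hs.1, hsb⟩]
    · have hgi := hY.intervalIntegrable_of_mem (left_mem_Icc.2 hY.le) ⟨hbs.le, hs.2⟩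
      rw [integral_piecewise_Iic hX.le hbs.le hX.intervalIntegrable hgi,
        piecewise_eq_of_notMem (Iic b) _ _ (not_le.2 hbs), hY.eq_add_integral s ⟨hbs.le, hs.2⟩,
        hX.eq_add_integral b (right_mem_Icc.2 hX.le), add_assoc]

end IsCaratheodorySolution

theorem absolutelyContinuousOnInterval_of_dist_le_integral {Y : Type*} [PseudoMetricSpace Y]
    {g : ℝ → Y} {φ : ℝ → ℝ} {a b : ℝ} (hab : a ≤ b) (hφ : IntervalIntegrable φ volume a b)
    (hg : ∀ r ∈ Icc a b, ∀ s ∈ Icc a b, r ≤ s → dist (g r) (g s) ≤ ∫ z in r..s, φ z) :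
    AbsolutelyContinuousOnInterval g a b := by
  have hdist : ∀ r ∈ Icc a b, ∀ s ∈ Icc a b, r ≤ s →
      dist (g r) (g s) ≤ dist (∫ z in a..r, φ z) (∫ z in a..s, φ z) := by
    intro r hr s hs hrs
    have hi : ∀ c ∈ Icc a b, IntervalIntegrable φ volume a c := fun c hc =>
      hφ.mono_set (uIcc_subset_uIcc_left (by rwa [uIcc_of_le hab]))
    rw [dist_comm (∫ z in a..r, φ z), Real.dist_eq,
      intervalIntegral.integral_interval_sub_left (hi s hs) (hi r hr)]
    exact (hg r hr s hs hrs).trans (le_abs_self _)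
  have hac := absolutelyContinuousOnInterval_iff _ _ _ |>.1 <|
    hφ.absolutelyContinuousOnInterval_intervalIntegral left_mem_uIcc
  refine (absolutelyContinuousOnInterval_iff _ _ _).2 fun ε hε => ?_
  obtain ⟨δ, hδ, hlt⟩ := hac ε hε
  refine ⟨δ, hδ, fun F hF hFδ => (Finset.sum_le_sum fun i hi => ?_).trans_lt (hlt F hF hFδ)⟩
  obtain ⟨hr, hs⟩ := hF.1 i hi
  rw [uIcc_of_le hab] at hr hs
  rcases le_total (F.2 i).1 (F.2 i).2 with h | h
  · exact hdist _ hr _ hs h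
  · simpa only [dist_comm] using hdist _ hs _ hr h

namespace IsCaratheodorySolution

variable {E : Type*} [NormedAddCommGroup E] [NormedSpace ℝ E]
  {f : ℝ → E → E} {a b : ℝ} {x : E} {X : ℝ → E} {s : Set ℝ} {W : ℝ × E → ℝ}

theorem absolutelyContinuousOnInterval_comp (h : IsCaratheodorySolution f a b x X)
    (hs : Convex ℝ s) (hsub : Icc a b ⊆ s) (hW : ContDiffOn ℝ 1 W (s ×ˢ univ)) :
    AbsolutelyContinuousOnInterval (fun r => W (r, X r)) a b := by
  have hmaps : (fun r => (r, X r)) '' Icc a b ⊆ s ×ˢ univ :=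
    image_subset_iff.2 fun r hr => ⟨hsub hr, mem_univ _⟩
  obtain ⟨K, hK⟩ := ((hW.locallyLipschitzOn (hs.prod convex_univ)).mono
    hmaps).exists_lipschitzOnWith_of_compact
      (isCompact_Icc.image_of_continuousOn (continuousOn_id.prodMk h.continuousOn))
  have hint : IntervalIntegrable (fun r => 1 + ‖f r (X r)‖) volume a b :=
    intervalIntegrable_const.add h.intervalIntegrable.norm
  refine absolutelyContinuousOnInterval_of_dist_le_integral h.le (hint.const_mul K)
    fun r hr t ht hrt => ?_
  have hcurve : dist (r, X r) (t, X t) ≤ ∫ z in r..t, (1 + ‖f z (X z)‖) := by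
    have hi := (h.intervalIntegrable_of_mem hr ht).norm
    have hX : ‖X t - X r‖ ≤ ∫ z in r..t, ‖f z (X z)‖ :=
      h.sub_eq_integral hr ht ▸ intervalIntegral.norm_integral_le_integral_norm hrt
    rw [intervalIntegral.integral_add intervalIntegrable_const hi, intervalIntegral.integral_const,
      smul_eq_mul, mul_one, dist_comm, Prod.dist_eq, Real.dist_eq, abs_of_nonneg (sub_nonneg.2 hrt),
      dist_eq_norm]
    exact max_le (le_add_of_nonneg_right ((norm_nonneg _).trans hX))
      (hX.trans (le_add_of_nonneg_left (sub_nonneg.2 hrt)))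
  rw [intervalIntegral.integral_const_mul]
  exact (hK.dist_le_mul _ (mem_image_of_mem _ hr) _ (mem_image_of_mem _ ht)).trans
    (mul_le_mul_of_nonneg_left hcurve K.2)

theorem integral_fderivWithin [CompleteSpace E] (h : IsCaratheodorySolution f a b x X)
    (hs : Convex ℝ s) (hsub : Icc a b ⊆ s) (hW : ContDiffOn ℝ 1 W (s ×ˢ univ)) :
    ∫ r in a..b, fderivWithin ℝ W (s ×ˢ univ) (r, X r) (1, f r (X r)) =
      W (b, X b) - W (a, X a) := by
  rw [← (h.absolutelyContinuousOnInterval_comp hs hsub hW).integral_deriv_eq_sub]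
  refine intervalIntegral.integral_congr_ae ?_
  filter_upwards [h.ae_hasDerivAt, Measure.ae_ne volume b] with r hr hrb hrab
  rw [uIoc_of_le h.le] at hrab
  have hrI : r ∈ Ioo a b := ⟨hrab.1, lt_of_le_of_ne hrab.2 hrb⟩
  have hnhds : s ×ˢ univ ∈ nhds (r, X r) :=
    prod_mem_nhds (Filter.mem_of_superset (Icc_mem_nhds hrI.1 hrI.2) hsub) Filter.univ_mem
  have hWr := ((hW.differentiableOn one_ne_zero) _ (mem_of_mem_nhds hnhds)).hasFDerivWithinAt
  exact ((hWr.hasFDerivAt hnhds).comp_hasDerivAt r ((hasDerivAt_id r).prodMk (hr hrI))).deriv.symm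

end IsCaratheodorySolution

section Lipschitz

variable {a b : ℝ} {K : NNReal}

theorem continuousOn_comp_prodMk {F G : Type*} [TopologicalSpace F] [TopologicalSpace G]
    {f : ℝ → F → G} {I : Set ℝ} {X : ℝ → F}
    (hf : ContinuousOn (fun p : ℝ × F => f p.1 p.2) (I ×ˢ univ)) (hX : ContinuousOn X I) :
    ContinuousOn (fun s => f s (X s)) I :=
  hf.comp (continuousOn_id.prodMk hX) fun _ hs => ⟨hs, mem_univ _⟩

theorem exists_norm_le_one_add_norm_sub {F G : Type*} [NormedAddCommGroup F]
    [NormedAddCommGroup G] {f : ℝ → F → G} (hlip : ∀ t ∈ Icc a b, LipschitzWith K (f t))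
    (hcont : ContinuousOn (fun p : ℝ × F => f p.1 p.2) (Icc a b ×ˢ univ)) (x : F) :
    ∃ N, 0 ≤ N ∧ ∀ t ∈ Icc a b, ∀ y, ‖f t y‖ ≤ N * (1 + ‖y - x‖) := by
  obtain ⟨M, hM⟩ := isCompact_Icc.exists_bound_of_continuousOn
    (continuousOn_comp_prodMk hcont (continuousOn_const (c := x)))
  refine ⟨max M K, le_max_of_le_right K.2, fun t ht y => ?_⟩
  calc ‖f t y‖ ≤ ‖f t x‖ + ‖f t y - f t x‖ := norm_le_norm_add_norm_sub' _ _
    _ ≤ M + K * ‖y - x‖ := add_le_add (hM t ht) ((hlip t ht).norm_sub_le y x)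
    _ ≤ max M K * (1 + ‖y - x‖) := by
      rw [mul_add, mul_one]
      gcongr
      exacts [le_max_left _ _, le_max_right _ _]

variable {E : Type*} [NormedAddCommGroup E] [NormedSpace ℝ E] [CompleteSpace E]
  {f : ℝ → E → E}

theorem exists_isCaratheodorySolution_of_mul_le_half (hab : a ≤ b)
    (hlip : ∀ t ∈ Icc a b, LipschitzWith K (f t))
    (hcont : ContinuousOn (fun p : ℝ × E => f p.1 p.2) (Icc a b ×ˢ univ))
    (hK : K * (b - a) ≤ 1 / 2) (x : E) : ∃ X, IsCaratheodorySolution f a b x X := by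
  obtain ⟨M', hM'⟩ := isCompact_Icc.exists_bound_of_continuousOn
    (continuousOn_comp_prodMk hcont (continuousOn_const (c := x)))
  lift b - a to NNReal using sub_nonneg.2 hab with h hh
  set M : NNReal := M'.toNNReal
  set ρ : NNReal := 2 * M * h with hρ
  have hpicard : IsPicardLindelof f (tmin := a) (tmax := b) ⟨a, left_mem_Icc.2 hab⟩ x ρ 0
      (M + K * ρ) K := by
    refine ⟨fun t ht => (hlip t ht).lipschitzOnWith,
      fun y _ => continuousOn_comp_prodMk hcont continuousOn_const, fun t ht y hy => ?_, ?_⟩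
    · rw [mem_closedBall_iff_norm] at hy
      calc ‖f t y‖ ≤ ‖f t x‖ + ‖f t y - f t x‖ := norm_le_norm_add_norm_sub' _ _
        _ ≤ M + K * ‖y - x‖ :=
          add_le_add ((hM' t ht).trans (Real.le_coe_toNNReal M')) ((hlip t ht).norm_sub_le y x)
        _ ≤ M + K * ρ := by gcongr
    · have hρK : (K * h : ℝ) * ρ ≤ 1 / 2 * ρ := by gcongr
      rw [sub_self, ← hh, max_eq_left h.coe_nonneg]
      push_cast [hρ] at hρK ⊢
      linarith
  obtain ⟨X, hXa, hX⟩ := hpicard.exists_eq_forall_mem_Icc_hasDerivWithinAt₀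
  have hXc : ContinuousOn X (Icc a b) := fun s hs => (hX s hs).continuousWithinAt
  have hfX : ContinuousOn (fun s => f s (X s)) (Icc a b) := continuousOn_comp_prodMk hcont hXc
  refine ⟨X, hab, hfX.intervalIntegrable_of_Icc hab, fun s hs => ?_⟩
  have hsub : Icc a s ⊆ Icc a b := Icc_subset_Icc_right hs.2
  rw [intervalIntegral.integral_eq_sub_of_hasDerivAt_of_le hs.1 (hXc.mono hsub)
    (fun r hr => (hX r (hsub (Ioo_subset_Icc_self hr))).hasDerivAt
      (Icc_mem_nhds hr.1 (hr.2.trans_le hs.2)))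
    ((hfX.mono hsub).intervalIntegrable_of_Icc hs.1), hXa, add_sub_cancel]

theorem exists_isCaratheodorySolution (hab : a ≤ b)
    (hlip : ∀ t ∈ Icc a b, LipschitzWith K (f t))
    (hcont : ContinuousOn (fun p : ℝ × E => f p.1 p.2) (Icc a b ×ˢ univ)) (x : E) :
    ∃ X, IsCaratheodorySolution f a b x X := by
  obtain ⟨N, hN⟩ := exists_nat_ge (2 * (K * (b - a)))
  induction N generalizing b with
  | zero =>
    refine exists_isCaratheodorySolution_of_mul_le_half hab hlip hcont ?_ x
    rw [Nat.cast_zero] at hN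
    linarith
  | succ N ih =>
    -- cut `[a, b]` so that the right piece has length `(b - a) / (N + 1)`
    set c : ℝ := b - (b - a) / (N + 1) with hc
    have hright : (N + 1) * (b - c) = b - a := by rw [hc]; field_simp; ring
    have hleft : c - a = N * (b - c) := by linarith
    have hcb : c ≤ b := sub_le_self _ (div_nonneg (sub_nonneg.2 hab) (by positivity))
    have hac : a ≤ c :=
      sub_nonneg.1 (hleft ▸ mul_nonneg N.cast_nonneg (sub_nonneg.2 hcb))
    have hK : 2 * (K * (b - c)) ≤ 1 := by
      rw [Nat.cast_add_one, ← hright] at hN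
      exact le_of_mul_le_mul_left (by linarith) N.cast_add_one_pos
    have hNK : 2 * (K * (c - a)) ≤ N := by
      rw [hleft]
      linarith [mul_le_mul_of_nonneg_left hK (N.cast_nonneg (α := ℝ))]
    obtain ⟨X, hX⟩ := ih hac (fun t ht => hlip t ⟨ht.1, ht.2.trans hcb⟩)
      (hcont.mono (prod_mono_left (Icc_subset_Icc_right hcb))) hNK
    obtain ⟨Y, hY⟩ := exists_isCaratheodorySolution_of_mul_le_half hcb
      (fun t ht => hlip t ⟨hac.trans ht.1, ht.2⟩)
      (hcont.mono (prod_mono_left (Icc_subset_Icc_left hac))) (by linarith) (X c)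
    exact ⟨_, piecewise_same (Iic c) f ▸ hX.piecewise hY⟩

end Lipschitz

theorem IsCaratheodorySolution.norm_sub_le_two_mul_integral {E : Type*} [NormedAddCommGroup E]
    [NormedSpace ℝ E] {f : ℝ → E → E} {a b : ℝ} {x : E} {X : ℝ → E} {φ : ℝ → ℝ}
    (h : IsCaratheodorySolution f a b x X) (hφ : IntervalIntegrable φ volume a b)
    (hf : ∀ s ∈ Icc a b, ‖f s (X s)‖ ≤ φ s * (1 + ‖X s - x‖))
    (hφ_le : ∫ s in a..b, φ s ≤ 1 / 2) {s : ℝ} (hs : s ∈ Icc a b) :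
    ‖X s - x‖ ≤ 2 * ∫ r in a..b, φ r := by
  have ha := left_mem_Icc.2 h.le
  obtain ⟨c, hc, hmax⟩ : ∃ c ∈ Icc a b, ∀ r ∈ Icc a b, ‖X r - x‖ ≤ ‖X c - x‖ :=
    isCompact_Icc.exists_isMaxOn ⟨a, ha⟩ (h.continuousOn.sub continuousOn_const).norm
  have hbound : ∀ r ∈ Icc a b, ‖f r (X r)‖ ≤ φ r * (1 + ‖X c - x‖) := by
    intro r hr
    have hφr : 0 ≤ φ r :=
      nonneg_of_mul_nonneg_left ((norm_nonneg _).trans (hf r hr)) (by positivity)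
    exact (hf r hr).trans (by gcongr; exact hmax r hr)
  have hle : ‖X c - x‖ ≤ (∫ r in a..b, φ r) * (1 + ‖X c - x‖) := by
    calc ‖X c - x‖ = ‖∫ r in a..c, f r (X r)‖ := by
          rw [← h.sub_eq_integral ha hc, h.apply_left]
      _ ≤ ∫ r in a..c, ‖f r (X r)‖ := intervalIntegral.norm_integral_le_integral_norm hc.1
      _ ≤ ∫ r in a..b, ‖f r (X r)‖ :=
          intervalIntegral.integral_mono_interval le_rfl hc.1 hc.2
            (Filter.Eventually.of_forall fun r => norm_nonneg _) h.intervalIntegrable.norm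
      _ ≤ ∫ r in a..b, φ r * (1 + ‖X c - x‖) :=
          intervalIntegral.integral_mono_on h.le h.intervalIntegrable.norm (hφ.mul_const _) hbound
      _ = (∫ r in a..b, φ r) * (1 + ‖X c - x‖) := intervalIntegral.integral_mul_const _ _
  have hhalf : (∫ r in a..b, φ r) * ‖X c - x‖ ≤ 1 / 2 * ‖X c - x‖ := by gcongr
  exact (hmax s hs).trans (by linarith)

theorem two_mul_integral_norm_le {F : Type*} [NormedAddCommGroup F] {u : ℝ → F} {a b η : ℝ}
    (hab : a ≤ b) (hη : 0 < η) (hu : MemLp u 2 (volume.restrict (Icc a b))) :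
    2 * ∫ s in a..b, ‖u s‖ ≤ η * (∫ s in a..b, ‖u s‖ ^ 2) + (b - a) / η := by
  have hu1 : IntervalIntegrable (fun s => ‖u s‖) volume a b :=
    (intervalIntegrable_iff_integrableOn_Icc_of_le hab).2 (hu.integrable one_le_two).norm
  have hu2 : IntervalIntegrable (fun s => ‖u s‖ ^ 2) volume a b :=
    (intervalIntegrable_iff_integrableOn_Icc_of_le hab).2 hu.integrable_norm_pow'
  have hyoung : ∀ s, 2 * ‖u s‖ ≤ η * ‖u s‖ ^ 2 + 1 / η := fun s => by
    have hsq : η * ‖u s‖ ^ 2 + 1 / η - 2 * ‖u s‖ = (η * ‖u s‖ - 1) ^ 2 / η := by field_simp; ring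
    linarith [show 0 ≤ (η * ‖u s‖ - 1) ^ 2 / η by positivity]
  calc 2 * ∫ s in a..b, ‖u s‖ = ∫ s in a..b, 2 * ‖u s‖ :=
        (intervalIntegral.integral_const_mul _ _).symm
    _ ≤ ∫ s in a..b, (η * ‖u s‖ ^ 2 + 1 / η) :=
        intervalIntegral.integral_mono hab (hu1.const_mul _)
          ((hu2.const_mul _).add intervalIntegrable_const) hyoung
    _ = η * (∫ s in a..b, ‖u s‖ ^ 2) + (b - a) / η := by
        rw [intervalIntegral.integral_add (hu2.const_mul _) intervalIntegrable_const,
          intervalIntegral.integral_const_mul, intervalIntegral.integral_const, smul_eq_mul,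
          mul_one_div]

theorem nonneg_left_of_integral_nonneg {g : ℝ → ℝ} {a b : ℝ} (hab : a < b)
    (hg : ContinuousOn g (Icc a b)) (h : ∀ c ∈ Ioc a b, 0 ≤ ∫ s in a..c, g s) : 0 ≤ g a := by
  by_contra! hlt
  have hev : ∀ᶠ s in nhdsWithin a (Icc a b), g s < 0 :=
    (hg a (left_mem_Icc.2 hab.le)).eventually_lt_const hlt
  rw [nhdsWithin_Icc_eq_nhdsGE hab, Filter.Eventually, mem_nhdsGE_iff_exists_mem_Ioc_Ico_subset hab]
    at hev
  obtain ⟨c, hc, hneg⟩ := hev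
  have hpos : 0 < ∫ s in a..c, -g s :=
    intervalIntegral.intervalIntegral_pos_of_pos_on
      ((hg.mono (Icc_subset_Icc_right hc.2)).neg.intervalIntegrable_of_Icc hc.1.le)
      (fun s hs => neg_pos.2 (hneg (Ioo_subset_Ico_self hs))) hc.1
  rw [intervalIntegral.integral_neg] at hpos
  linarith [h c hc]

section Hilbert

variable {H : Type*} [NormedAddCommGroup H] [InnerProductSpace ℝ H] {M : H →L[ℝ] H}

theorem isInvertible_of_coercive [FiniteDimensional ℝ H] {c : ℝ} (hc : 0 < c)
    (hM : ∀ u, c * ‖u‖ ^ 2 ≤ inner ℝ (M u) u) : M.IsInvertible := by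
  have hinj : Function.Injective M.toLinearMap := by
    refine (injective_iff_map_eq_zero _).2 fun u hu => ?_
    have hu0 : c * ‖u‖ ^ 2 ≤ 0 := by simpa [show M u = 0 from hu] using hM u
    simpa using nonpos_of_mul_nonpos_right hu0 hc
  exact ⟨(LinearEquiv.ofInjectiveEndo M.toLinearMap hinj).toContinuousLinearEquiv, by ext1; rfl⟩

/-- Completing the square at the critical point `w` of `u ↦ ⟨v, u⟩ + ½⟨M u, u⟩`. -/
theorem inner_add_half_inner_eq_of_isSelfAdjoint [CompleteSpace H] (hM : IsSelfAdjoint M) {v w : H}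
    (hw : M w = -v) (u : H) :
    inner ℝ v u + 1 / 2 * inner ℝ (M u) u =
      (inner ℝ v w + 1 / 2 * inner ℝ (M w) w) + 1 / 2 * inner ℝ (M (u - w)) (u - w) := by
  have hsymm : inner ℝ (M u) w = -inner ℝ v u := by
    rw [hM.isSymmetric.apply_clm u w, hw, inner_neg_right, real_inner_comm]
  rw [map_sub, inner_sub_left, inner_sub_right, inner_sub_right, hsymm, hw, inner_neg_left,
    inner_neg_left]
  ring

theorem neg_half_inner_inverse_le [CompleteSpace H] (hM : IsSelfAdjoint M) (hinv : M.IsInvertible)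
    (hnonneg : ∀ u, 0 ≤ inner ℝ (M u) u) (v u : H) :
    -(1 / 2 * inner ℝ v (M.inverse v)) ≤ inner ℝ v u + 1 / 2 * inner ℝ (M u) u := by
  have hw : M (-M.inverse v) = -v := by rw [map_neg, hinv.self_apply_inverse]
  rw [inner_add_half_inner_eq_of_isSelfAdjoint hM hw u, hw, inner_neg_neg, inner_neg_right]
  linarith [hnonneg (u - -M.inverse v)]

/-- Divide the bound at `±l u` by `l ^ 2` and let `l → ∞`. -/
theorem two_mul_le_inner_of_forall_le {v : H} {κ q C : ℝ}
    (h : ∀ u, κ * ‖u‖ ^ 2 - C ≤ q + inner ℝ v u + 1 / 2 * inner ℝ (M u) u) (u : H) :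
    2 * κ * ‖u‖ ^ 2 ≤ inner ℝ (M u) u := by
  have hscaled : ∀ l : ℝ, (2 * κ * ‖u‖ ^ 2 - inner ℝ (M u) u) * l ^ 2 ≤ 2 * (q + C) := by
    intro l
    have hl := h (l • u)
    have hl' := h (-l • u)
    simp only [norm_smul, map_smul, inner_smul_left, inner_smul_right, norm_neg, mul_pow,
      Real.norm_eq_abs, sq_abs, RCLike.conj_to_real] at hl hl'
    linarith
  by_contra! hlt
  have hpos : 0 < 2 * κ * ‖u‖ ^ 2 - inner ℝ (M u) u := sub_pos.2 hlt
  obtain ⟨l, hl⟩ := (((Filter.tendsto_pow_atTop two_ne_zero).const_mul_atTop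
    hpos).eventually_gt_atTop (2 * (q + C))).exists
  exact (hscaled l).not_gt hl

end Hilbert

section Integrability

variable {E F : Type*} [NormedAddCommGroup E] [NormedSpace ℝ E] [NormedAddCommGroup F]
  [NormedSpace ℝ F] {a b : ℝ}

theorem memLp_clm_apply {M : ℝ → E →L[ℝ] F} {u : ℝ → E} {p : ENNReal}
    (hM : ContinuousOn M (Icc a b)) (hu : MemLp u p (volume.restrict (Icc a b))) :
    MemLp (fun s => M s (u s)) p (volume.restrict (Icc a b)) := by
  obtain ⟨C, hC⟩ := isCompact_Icc.exists_bound_of_continuousOn hM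
  refine hu.of_le_mul (c := C) (isBoundedBilinearMap_apply.continuous.comp_aestronglyMeasurable
    ((hM.aestronglyMeasurable_of_isCompact isCompact_Icc measurableSet_Icc).prodMk hu.1)) ?_
  filter_upwards [ae_restrict_mem measurableSet_Icc] with s hs
  exact ((M s).le_opNorm _).trans (mul_le_mul_of_nonneg_right (hC s hs) (norm_nonneg _))

variable {H : Type*} [NormedAddCommGroup H] [InnerProductSpace ℝ H] {a b : ℝ} {v w : ℝ → H}

theorem intervalIntegrable_inner_of_memLp (hab : a ≤ b)
    (hv : MemLp v 2 (volume.restrict (Icc a b))) (hw : MemLp w 2 (volume.restrict (Icc a b))) :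
    IntervalIntegrable (fun s => inner ℝ (v s) (w s)) volume a b :=
  (intervalIntegrable_iff_integrableOn_Icc_of_le hab).2 <|
    (hv.norm.integrable_mul hw.norm).mono (hv.1.inner hw.1) <|
      Filter.Eventually.of_forall fun s => (norm_inner_le_norm _ _).trans (le_abs_self _)

end Integrability

section Slice

variable {E F : Type*} [NormedAddCommGroup E] [NormedSpace ℝ E] [NormedAddCommGroup F]
  [NormedSpace ℝ F] {f : ℝ × E → F} {f' : ℝ × E →L[ℝ] F} {I : Set ℝ} {t : ℝ} {x : E}

theorem hasFDerivAt_slice (ht : t ∈ I) (hf : HasFDerivWithinAt f f' (I ×ˢ univ) (t, x)) :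
    HasFDerivAt (fun y => f (t, y)) (f' ∘L ContinuousLinearMap.inr ℝ ℝ E) x := by
  rw [← hasFDerivWithinAt_univ]
  exact hf.comp x (hasFDerivAt_prodMk_right t x).hasFDerivWithinAt fun y _ => ⟨ht, mem_univ y⟩

theorem hasDerivWithinAt_slice (hf : HasFDerivWithinAt f f' (I ×ˢ univ) (t, x)) :
    HasDerivWithinAt (fun s => f (s, x)) (f' (1, 0)) I t :=
  hf.comp_hasDerivWithinAt (f := fun s => (s, x)) t
    ((hasDerivWithinAt_id t I).prodMk (hasDerivWithinAt_const t I x)) fun _ hs => ⟨hs, mem_univ x⟩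

theorem differentiable_slice {g : ℝ → E → F}
    (hg : DifferentiableOn ℝ (fun p : ℝ × E => g p.1 p.2) (I ×ˢ univ)) (ht : t ∈ I) :
    Differentiable ℝ (g t) := fun x =>
  (hasFDerivAt_slice ht (hg (t, x) ⟨ht, mem_univ x⟩).hasFDerivWithinAt).differentiableAt

end Slice

namespace AQProblem

variable {n m : ℕ}

/-- The right-hand side `A(s, x) + B(s, x) u` of the state equation. -/
noncomputable def velocity (D : AQProblem n m) (s : ℝ) (x : Euc n) (u : Euc m) : Euc n :=
  D.A s x + D.B s x u

/-- The running cost `Q(s, x) + ⟨S(s, x), u⟩ + ½ ⟨R(s, x) u, u⟩`. -/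
noncomputable def running (D : AQProblem n m) (s : ℝ) (x : Euc n) (u : Euc m) : ℝ :=
  D.Q s x + inner ℝ (D.S s x) u + 1 / 2 * inner ℝ (D.R s x u) u

/-- The pair `(X, u)` of a path and a square integrable control solves the state equation on
`[a, b]` with `X(a) = x`; for `b = T` these are the admissible pairs. -/
structure IsControlledPath (D : AQProblem n m) (a b : ℝ) (x : Euc n) (X : ℝ → Euc n)
    (u : ℝ → Euc m) : Prop where
  memLp : MemLp u 2 (volume.restrict (Icc a b))
  isSolution : IsCaratheodorySolution (fun s y => D.velocity s y (u s)) a b x X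

/-- A weak form of (H1): the coefficients of the state equation are continuous, and Lipschitz
continuous in the state uniformly in time. -/
structure LipschitzDynamics (D : AQProblem n m) : Prop where
  continuousOn_A : ContinuousOn (fun p : ℝ × Euc n => D.A p.1 p.2) D.dom
  continuousOn_B : ContinuousOn (fun p : ℝ × Euc n => D.B p.1 p.2) D.dom
  exists_lipschitzWith : ∃ K, ∀ t ∈ Icc 0 D.T, LipschitzWith K (D.A t) ∧ LipschitzWith K (D.B t)

/-- A weak form of (H2): the running cost is continuous and bounded below by a coercive quadratic
function of the control alone, and the terminal cost is bounded below. -/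
structure CoerciveCost (D : AQProblem n m) : Prop where
  continuousOn_Q : ContinuousOn (fun p : ℝ × Euc n => D.Q p.1 p.2) D.dom
  continuousOn_S : ContinuousOn (fun p : ℝ × Euc n => D.S p.1 p.2) D.dom
  continuousOn_R : ContinuousOn (fun p : ℝ × Euc n => D.R p.1 p.2) D.dom
  isSelfAdjoint_R : ∀ t ∈ Icc 0 D.T, ∀ x, IsSelfAdjoint (D.R t x)
  exists_le_running :
    ∃ κ > 0, ∃ C, ∀ t ∈ Icc 0 D.T, ∀ x u, κ * ‖u‖ ^ 2 - C ≤ D.running t x u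
  bddBelow_G : BddBelow (range D.G)

variable {D : AQProblem n m}

section Hypotheses

theorem H1.lipschitzDynamics (h : D.H1) : D.LipschitzDynamics := by
  obtain ⟨hA, hB, LA, _, LB', -, -, -, hLA, hLB', -⟩ := h
  refine ⟨hA, hB, max LA.toNNReal LB'.toNNReal, fun t ht => ⟨?_, ?_⟩⟩
  · exact (LipschitzWith.of_dist_le_mul (K := LA.toNNReal) fun x y => by
      rw [dist_eq_norm, dist_eq_norm]
      exact (hLA t ht x y).trans (by gcongr; exact Real.le_coe_toNNReal LA)).weaken
        (le_max_left _ _)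
  · exact (LipschitzWith.of_dist_le_mul (K := LB'.toNNReal) fun x y => by
      rw [dist_eq_norm, dist_eq_norm]
      exact (hLB' t ht x y).trans (by gcongr; exact Real.le_coe_toNNReal LB')).weaken
        (le_max_right _ _)

/-- The bound on `(1 - ε) Q - ½ ⟨S, R⁻¹ S⟩` controls the running cost with `(1 - ε) R` in place of
`R`, as one sees by minimizing at the control `(1 - ε) u`; the remaining `½ ε ⟨R u, u⟩` is
coercive. -/
theorem le_running_of_le {t L ε ρ : ℝ} {x : Euc n} (hε : 0 < ε) (hε1 : ε < 1) (hρ : 0 < ρ)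
    (hsa : IsSelfAdjoint (D.R t x)) (hR : ∀ u, ρ * ‖u‖ ^ 2 ≤ inner ℝ (D.R t x u) u)
    (hL : -L ≤ (1 - ε) * D.Q t x - 1 / 2 * inner ℝ (D.S t x) ((D.R t x).inverse (D.S t x)))
    (u : Euc m) : ε * ρ / 2 * ‖u‖ ^ 2 - L / (1 - ε) ≤ D.running t x u := by
  have hδ : 0 < 1 - ε := sub_pos.2 hε1
  have hmin := neg_half_inner_inverse_le hsa (isInvertible_of_coercive hρ hR)
    (fun v => (by positivity : (0 : ℝ) ≤ ρ * ‖v‖ ^ 2).trans (hR v)) (D.S t x) ((1 - ε) • u)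
  simp only [map_smul, inner_smul_left, inner_smul_right, RCLike.conj_to_real] at hmin
  have hreduced : -(L / (1 - ε)) ≤
      D.Q t x + inner ℝ (D.S t x) u + 1 / 2 * ((1 - ε) * inner ℝ (D.R t x u) u) := by
    rw [← neg_div, div_le_iff₀' hδ]
    linarith
  have hcoercive := mul_le_mul_of_nonneg_left (hR u) hε.le
  rw [running]
  linarith

theorem H2.coerciveCost (h : D.H2) : D.CoerciveCost := by
  obtain ⟨hQ, hS, hR, -, hsa, L, _, _, _, ε, ρ₀, ρ, -, -, -, -, hε, hε1, hρ₀, -, hρ, hG, -, hlow⟩ :=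
    h
  refine ⟨hQ, hS, hR, hsa, ⟨ε * ρ₀ / 2, by positivity, L / (1 - ε), fun t ht x u => ?_⟩,
    -L, forall_mem_range.2 hG⟩
  obtain ⟨hρR, hL, -⟩ := hlow t ht x
  exact le_running_of_le hε hε1 hρ₀ (hsa t ht x)
    (fun v => (mul_le_mul_of_nonneg_right (hρ x) (sq_nonneg _)).trans (hρR v)) hL u

theorem CoerciveCost.exists_le_inner_R (h : D.CoerciveCost) :
    ∃ c > 0, ∀ t ∈ Icc 0 D.T, ∀ x u, c * ‖u‖ ^ 2 ≤ inner ℝ (D.R t x u) u := by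
  obtain ⟨κ, hκ, C, hC⟩ := h.exists_le_running
  exact ⟨2 * κ, by positivity, fun t ht x => two_mul_le_inner_of_forall_le (hC t ht x)⟩

theorem CoerciveCost.isInvertible_R (h : D.CoerciveCost) {t : ℝ} (ht : t ∈ Icc 0 D.T)
    (x : Euc n) : (D.R t x).IsInvertible :=
  have ⟨_, hc, hle⟩ := h.exists_le_inner_R
  isInvertible_of_coercive hc (hle t ht x)

theorem CoerciveCost.inner_R_nonneg (h : D.CoerciveCost) {t : ℝ} (ht : t ∈ Icc 0 D.T)
    (x : Euc n) (u : Euc m) : 0 ≤ inner ℝ (D.R t x u) u := by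
  obtain ⟨c, hc, hle⟩ := h.exists_le_inner_R
  exact (by positivity : (0 : ℝ) ≤ c * ‖u‖ ^ 2).trans (hle t ht x u)

end Hypotheses

namespace IsControlledPath

variable {a b c d : ℝ} {x : Euc n} {X Y : ℝ → Euc n} {u v : ℝ → Euc m}

theorem subinterval (h : D.IsControlledPath a b x X u) (hac : a ≤ c) (hcd : c ≤ d) (hdb : d ≤ b) :
    D.IsControlledPath c d (X c) X u :=
  ⟨h.memLp.mono_measure (Measure.restrict_mono (Icc_subset_Icc hac hdb) le_rfl),
    h.isSolution.subinterval hac hcd hdb⟩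

theorem piecewise (hX : D.IsControlledPath a b x X u) (hY : D.IsControlledPath b c (X b) Y v) :
    D.IsControlledPath a c x ((Iic b).piecewise X Y) ((Iic b).piecewise u v) := by
  refine ⟨memLp_piecewise_Iic hX.memLp hY.memLp, ?_⟩
  convert hX.isSolution.piecewise hY.isSolution using 1
  ext1 s
  by_cases hs : s ∈ Iic b <;> simp [hs]

theorem continuousOn_comp {F : Type*} [TopologicalSpace F] {f : ℝ → Euc n → F}
    (h : D.IsControlledPath a b x X u) (ha : 0 ≤ a) (hb : b ≤ D.T)
    (hf : ContinuousOn (fun p : ℝ × Euc n => f p.1 p.2) D.dom) :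
    ContinuousOn (fun s => f s (X s)) (Icc a b) :=
  continuousOn_comp_prodMk (hf.mono (prod_mono_left (Icc_subset_Icc ha hb)))
    h.isSolution.continuousOn

theorem intervalIntegrable_running (h : D.IsControlledPath a b x X u) (hD : D.CoerciveCost)
    (ha : 0 ≤ a) (hb : b ≤ D.T) :
    IntervalIntegrable (fun s => D.running s (X s) (u s)) volume a b := by
  have hS := memLp_clm_apply ((innerSL ℝ).continuous.comp_continuousOn
    (h.continuousOn_comp ha hb hD.continuousOn_S)) h.memLp
  have hR := memLp_clm_apply (h.continuousOn_comp ha hb hD.continuousOn_R) h.memLp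
  have hab := h.isSolution.le
  exact (((h.continuousOn_comp ha hb hD.continuousOn_Q).intervalIntegrable_of_Icc hab).add
    ((intervalIntegrable_iff_integrableOn_Icc_of_le hab).2 (hS.integrable one_le_two))).add
    ((intervalIntegrable_inner_of_memLp hab hR h.memLp).const_mul _)

end IsControlledPath

variable {a b t : ℝ} {x : Euc n} {X : ℝ → Euc n} {u : ℝ → Euc m}

theorem isAdmissiblePair_iff (ht : t ≤ D.T) :
    D.IsAdmissiblePair t x X u ↔ D.IsControlledPath t D.T x X u :=
  ⟨fun h => ⟨h.1, ht, (intervalIntegrable_iff_integrableOn_Icc_of_le ht).2 h.2.2.1, h.2.2.2⟩,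
    fun h => ⟨h.memLp, h.isSolution.continuousOn,
      (intervalIntegrable_iff_integrableOn_Icc_of_le ht).1 h.isSolution.intervalIntegrable,
      h.isSolution.eq_add_integral⟩⟩

theorem LipschitzDynamics.exists_isControlledPath_const (hD : D.LipschitzDynamics)
    (ht : t ∈ Icc 0 D.T) (x : Euc n) (u : Euc m) :
    ∃ X, D.IsControlledPath t D.T x X fun _ => u := by
  obtain ⟨K, hK⟩ := hD.exists_lipschitzWith
  have hsub : Icc t D.T ⊆ Icc 0 D.T := Icc_subset_Icc_left ht.1
  obtain ⟨X, hX⟩ := exists_isCaratheodorySolution (f := fun s y => D.velocity s y u) ht.2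
    (fun s hs => (hK s (hsub hs)).1.add
      ((ContinuousLinearMap.apply ℝ (Euc n) u).lipschitz.comp (hK s (hsub hs)).2))
    ((hD.continuousOn_A.add (hD.continuousOn_B.clm_apply continuousOn_const)).mono
      (prod_mono_left hsub)) x
  exact ⟨X, memLp_const u, hX⟩

theorem CoerciveCost.exists_le_cost (hD : D.CoerciveCost) :
    ∃ κ > 0, ∃ C, ∀ t ∈ Icc 0 D.T, ∀ x X u, D.IsControlledPath t D.T x X u →
      κ * (∫ s in t..D.T, ‖u s‖ ^ 2) - C ≤ D.cost t X u := by
  obtain ⟨κ, hκ, C, hC⟩ := hD.exists_le_running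
  obtain ⟨g, hg⟩ := hD.bddBelow_G
  refine ⟨κ, hκ, |C| * D.T - g, fun t ht x X u hX => ?_⟩
  have hu : IntervalIntegrable (fun s => κ * ‖u s‖ ^ 2) volume t D.T :=
    ((intervalIntegrable_iff_integrableOn_Icc_of_le ht.2).2
      hX.memLp.integrable_norm_pow').const_mul κ
  have hrunning : ∫ s in t..D.T, (κ * ‖u s‖ ^ 2 - C) ≤ ∫ s in t..D.T, D.running s (X s) (u s) :=
    intervalIntegral.integral_mono_on ht.2 (hu.sub intervalIntegrable_const)
      (hX.intervalIntegrable_running hD ht.1 le_rfl) fun s hs => hC s ⟨ht.1.trans hs.1, hs.2⟩ _ _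
  rw [intervalIntegral.integral_sub hu intervalIntegrable_const,
    intervalIntegral.integral_const_mul, intervalIntegral.integral_const, smul_eq_mul] at hrunning
  have hC' : (D.T - t) * C ≤ |C| * D.T :=
    calc (D.T - t) * C ≤ (D.T - t) * |C| := by gcongr; exacts [sub_nonneg.2 ht.2, le_abs_self C]
      _ ≤ D.T * |C| := by gcongr; linarith [ht.1]
      _ = |C| * D.T := mul_comm _ _
  change _ ≤ (∫ s in t..D.T, D.running s (X s) (u s)) + D.G (X D.T)
  linarith [hg (mem_range_self (X D.T))]

theorem CoerciveCost.value_le_cost (hD : D.CoerciveCost) (ht : t ∈ Icc 0 D.T)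
    (hX : D.IsControlledPath t D.T x X u) : D.value t x ≤ D.cost t X u := by
  obtain ⟨κ, hκ, C, hC⟩ := hD.exists_le_cost
  refine csInf_le ⟨-C, ?_⟩ ⟨X, u, (isAdmissiblePair_iff ht.2).2 hX, rfl⟩
  rintro _ ⟨Y, v, hY, rfl⟩
  have henergy : 0 ≤ κ * ∫ s in t..D.T, ‖v s‖ ^ 2 :=
    mul_nonneg hκ.le (intervalIntegral.integral_nonneg ht.2 fun s _ => sq_nonneg _)
  linarith [hC t ht x Y v ((isAdmissiblePair_iff ht.2).1 hY)]

theorem LipschitzDynamics.exists_cost_lt (hD : D.LipschitzDynamics) (ht : t ∈ Icc 0 D.T)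
    {ε : ℝ} (hε : 0 < ε) :
    ∃ X u, D.IsControlledPath t D.T x X u ∧ D.cost t X u < D.value t x + ε := by
  obtain ⟨Y, hY⟩ := hD.exists_isControlledPath_const ht x 0
  have hne : {c | ∃ X u, D.IsAdmissiblePair t x X u ∧ c = D.cost t X u}.Nonempty :=
    ⟨_, Y, _, (isAdmissiblePair_iff ht.2).2 hY, rfl⟩
  obtain ⟨_, ⟨X, u, hX, rfl⟩, hlt⟩ :=
    exists_lt_of_csInf_lt hne (lt_add_of_pos_right (D.value t x) hε)
  exact ⟨X, u, (isAdmissiblePair_iff ht.2).1 hX, hlt⟩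

theorem IsControlledPath.cost_piecewise {Y : ℝ → Euc n} {v : ℝ → Euc m} (hD : D.CoerciveCost)
    (ha : 0 ≤ a) (hX : D.IsControlledPath a b x X u)
    (hY : D.IsControlledPath b D.T (X b) Y v) :
    D.cost a ((Iic b).piecewise X Y) ((Iic b).piecewise u v) =
      (∫ s in a..b, D.running s (X s) (u s)) + D.cost b Y v := by
  have hab := hX.isSolution.le
  have hbT := hY.isSolution.le
  have hrunning : (fun s => D.running s ((Iic b).piecewise X Y s) ((Iic b).piecewise u v s)) =
      (Iic b).piecewise (fun s => D.running s (X s) (u s)) fun s => D.running s (Y s) (v s) := by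
    ext s
    by_cases hs : s ∈ Iic b <;> simp [hs]
  have hend : (Iic b).piecewise X Y D.T = Y D.T := by
    rcases hbT.lt_or_eq with hlt | rfl
    · exact piecewise_eq_of_notMem (Iic b) _ _ (not_le.2 hlt)
    · rw [piecewise_eq_of_mem (Iic D.T) _ _ self_mem_Iic, hY.isSolution.apply_left]
  change (∫ s in a..D.T, D.running s _ _) + D.G _ = _ + ((∫ s in b..D.T, D.running s _ _) + D.G _)
  rw [hend, hrunning, integral_piecewise_Iic hab hbT (hX.intervalIntegrable_running hD ha hbT)
    (hY.intervalIntegrable_running hD (ha.trans hab) le_rfl), add_assoc]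

theorem IsControlledPath.value_le (hLip : D.LipschitzDynamics) (hD : D.CoerciveCost)
    (ha : 0 ≤ a) (hb : b ≤ D.T) (hX : D.IsControlledPath a b x X u) :
    D.value a x ≤ (∫ s in a..b, D.running s (X s) (u s)) + D.value b (X b) := by
  refine le_of_forall_pos_le_add fun ε hε => ?_
  have hab := hX.isSolution.le
  obtain ⟨Y, v, hY, hlt⟩ := hLip.exists_cost_lt ⟨ha.trans hab, hb⟩ (x := X b) hε
  have hle := hD.value_le_cost ⟨ha, hab.trans hb⟩ (hX.piecewise hY)
  rw [hX.cost_piecewise hD ha hY] at hle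
  linarith

theorem IsControlledPath.integral_add_value_le_cost (hD : D.CoerciveCost) (ha : 0 ≤ a)
    (hab : a ≤ b) (hb : b ≤ D.T) (hX : D.IsControlledPath a D.T x X u) :
    (∫ s in a..b, D.running s (X s) (u s)) + D.value b (X b) ≤ D.cost a X u := by
  have hhead := hX.subinterval le_rfl hab hb
  have htail := hX.subinterval hab hb le_rfl
  have hcost := hhead.cost_piecewise hD ha htail
  rw [piecewise_same, piecewise_same] at hcost
  rw [hcost]
  linarith [hD.value_le_cost ⟨ha.trans hab, hb⟩ htail]

theorem LipschitzDynamics.value_terminal (hD : D.LipschitzDynamics) (x : Euc n) :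
    D.value D.T x = D.G x := by
  have hcost : ∀ X u, D.IsControlledPath D.T D.T x X u → D.cost D.T X u = D.G x := by
    intro X u hX
    rw [cost, intervalIntegral.integral_same, zero_add, hX.isSolution.apply_left]
  obtain ⟨X, hX⟩ := hD.exists_isControlledPath_const (right_mem_Icc.2 D.T_pos.le) x 0
  have hset : {c | ∃ X u, D.IsAdmissiblePair D.T x X u ∧ c = D.cost D.T X u} = {D.G x} := by
    refine Subset.antisymm ?_ (singleton_subset_iff.2
      ⟨X, _, (isAdmissiblePair_iff le_rfl).2 hX, (hcost X _ hX).symm⟩)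
    rintro _ ⟨Y, v, hY, rfl⟩
    exact hcost Y v ((isAdmissiblePair_iff le_rfl).1 hY)
  rw [value, hset, csInf_singleton]

end AQProblem

/-- The Riesz representative of `y ↦ φ (0, y)`: it maps the derivative of a function of time and
state to its gradient in the state. -/
noncomputable def stateGradient (E : Type*) [NormedAddCommGroup E] [InnerProductSpace ℝ E]
    [CompleteSpace E] : (ℝ × E →L[ℝ] ℝ) →L[ℝ] E :=
  (InnerProductSpace.toDual ℝ E).symm.toContinuousLinearEquiv.toContinuousLinearMap ∘L
    (ContinuousLinearMap.compL ℝ E (ℝ × E) ℝ).flip (ContinuousLinearMap.inr ℝ ℝ E)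

theorem inner_stateGradient {E : Type*} [NormedAddCommGroup E] [InnerProductSpace ℝ E]
    [CompleteSpace E] (φ : ℝ × E →L[ℝ] ℝ) (y : E) : inner ℝ (stateGradient E φ) y = φ (0, y) :=
  InnerProductSpace.toDual_symm_apply

namespace AQProblem

variable {n m : ℕ} {D : AQProblem n m} {W : ℝ → Euc n → ℝ}

/-- The derivative of `W` along the state equation plus the running cost,
`W_t + ⟨W_x, A + B u⟩ + Q + ⟨S, u⟩ + ½ ⟨R u, u⟩` at `(s, x)`. The Hamilton–Jacobi–Bellman equation
says that its minimum over `u` is zero. -/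
noncomputable def bellman (D : AQProblem n m) (W : ℝ → Euc n → ℝ) (s : ℝ) (x : Euc n)
    (u : Euc m) : ℝ :=
  fderivWithin ℝ (fun p : ℝ × Euc n => W p.1 p.2) D.dom (s, x) (1, D.velocity s x u) +
    D.running s x u

/-- The feedback control `-R⁻¹ (Bᵀ W_xᵀ + S)`, the minimizer of `u ↦ D.bellman W s x u`. -/
noncomputable def feedback (D : AQProblem n m) (W : ℝ → Euc n → ℝ) (s : ℝ) (x : Euc n) : Euc m :=
  -(D.R s x).inverse (ContinuousLinearMap.adjoint (D.B s x) (gradient (W s) x) + D.S s x)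

theorem uniqueDiffOn_dom (D : AQProblem n m) : UniqueDiffOn ℝ D.dom :=
  (uniqueDiffOn_Icc D.T_pos).prod uniqueDiffOn_univ

theorem gradient_eq_stateGradient (hW : DifferentiableOn ℝ (fun p : ℝ × Euc n => W p.1 p.2) D.dom)
    {p : ℝ × Euc n} (hp : p ∈ D.dom) :
    gradient (W p.1) p.2 =
      stateGradient (Euc n) (fderivWithin ℝ (fun p : ℝ × Euc n => W p.1 p.2) D.dom p) := by
  have hslice : HasFDerivAt (W p.1) _ p.2 := hasFDerivAt_slice hp.1 (hW p hp).hasFDerivWithinAt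
  rw [gradient, hslice.fderiv]
  rfl

section Bellman

variable {t : ℝ} {x : Euc n}

theorem bellman_eq_add_inner (hW : DifferentiableOn ℝ (fun p : ℝ × Euc n => W p.1 p.2) D.dom)
    (ht : t ∈ Icc 0 D.T) (u : Euc m) :
    D.bellman W t x u = D.bellman W t x 0 +
      (inner ℝ (ContinuousLinearMap.adjoint (D.B t x) (gradient (W t) x) + D.S t x) u +
        1 / 2 * inner ℝ (D.R t x u) u) := by
  have hgrad := gradient_eq_stateGradient hW (p := (t, x)) ⟨ht, mem_univ x⟩
  have hsplit : ((1 : ℝ), D.velocity t x u) = (1, D.velocity t x 0) + (0, D.B t x u) := by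
    simp [velocity]
  rw [bellman, hsplit, map_add, ← inner_stateGradient, ← hgrad, inner_add_left,
    ContinuousLinearMap.adjoint_inner_left, bellman, running, running, map_zero,
    inner_zero_left, inner_zero_right]
  ring

theorem CoerciveCost.bellman_eq_bellman_feedback_add (hD : D.CoerciveCost)
    (hW : DifferentiableOn ℝ (fun p : ℝ × Euc n => W p.1 p.2) D.dom) (ht : t ∈ Icc 0 D.T)
    (u : Euc m) :
    D.bellman W t x u = D.bellman W t x (D.feedback W t x) +
      1 / 2 * inner ℝ (D.R t x (u - D.feedback W t x)) (u - D.feedback W t x) := by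
  have hcrit : D.R t x (D.feedback W t x) =
      -(ContinuousLinearMap.adjoint (D.B t x) (gradient (W t) x) + D.S t x) := by
    rw [feedback, map_neg, (hD.isInvertible_R ht x).self_apply_inverse]
  rw [bellman_eq_add_inner hW ht u, bellman_eq_add_inner hW ht (D.feedback W t x),
    inner_add_half_inner_eq_of_isSelfAdjoint (hD.isSelfAdjoint_R t ht x) hcrit u]
  ring

theorem CoerciveCost.bellman_feedback_le (hD : D.CoerciveCost)
    (hW : DifferentiableOn ℝ (fun p : ℝ × Euc n => W p.1 p.2) D.dom) (ht : t ∈ Icc 0 D.T)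
    (u : Euc m) : D.bellman W t x (D.feedback W t x) ≤ D.bellman W t x u := by
  rw [hD.bellman_eq_bellman_feedback_add hW ht u]
  linarith [hD.inner_R_nonneg ht x (u - D.feedback W t x)]

end Bellman

section Continuity

theorem continuousOn_bellman {g : ℝ → Euc n → Euc m} (hLip : D.LipschitzDynamics)
    (hD : D.CoerciveCost) (hW : ContDiffOn ℝ 1 (fun p : ℝ × Euc n => W p.1 p.2) D.dom)
    (hg : ContinuousOn (fun p : ℝ × Euc n => g p.1 p.2) D.dom) :
    ContinuousOn (fun p : ℝ × Euc n => D.bellman W p.1 p.2 (g p.1 p.2)) D.dom := by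
  have hvelocity := hLip.continuousOn_A.add (hLip.continuousOn_B.clm_apply hg)
  have hrunning : ContinuousOn (fun p : ℝ × Euc n => D.running p.1 p.2 (g p.1 p.2)) D.dom :=
    (hD.continuousOn_Q.add (hD.continuousOn_S.inner hg)).add
      (continuousOn_const.mul ((hD.continuousOn_R.clm_apply hg).inner hg))
  exact ((hW.continuousOn_fderivWithin D.uniqueDiffOn_dom le_rfl).clm_apply
    (continuousOn_const.prodMk hvelocity)).add hrunning

theorem continuousOn_feedback (hLip : D.LipschitzDynamics) (hD : D.CoerciveCost)
    (hW : ContDiffOn ℝ 1 (fun p : ℝ × Euc n => W p.1 p.2) D.dom) :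
    ContinuousOn (fun p : ℝ × Euc n => D.feedback W p.1 p.2) D.dom := by
  have hinverse : ContinuousOn (fun p : ℝ × Euc n => (D.R p.1 p.2).inverse) D.dom := fun p hp =>
    ContinuousAt.comp_continuousWithinAt (f := fun p : ℝ × Euc n => D.R p.1 p.2)
      ((hD.isInvertible_R hp.1 p.2).contDiffAt_map_inverse (n := 0)).continuousAt
      (hD.continuousOn_R p hp)
  have hgradient : ContinuousOn (fun p : ℝ × Euc n => gradient (W p.1) p.2) D.dom :=
    ((stateGradient (Euc n)).continuous.comp_continuousOn
      (hW.continuousOn_fderivWithin D.uniqueDiffOn_dom le_rfl)).congr fun _ hp =>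
        gradient_eq_stateGradient (hW.differentiableOn one_ne_zero) hp
  have hadjoint : ContinuousOn
      (fun p : ℝ × Euc n => ContinuousLinearMap.adjoint (D.B p.1 p.2)) D.dom :=
    (ContinuousLinearMap.adjoint (𝕜 := ℝ) (E := Euc m) (F := Euc n)).continuous.comp_continuousOn
      hLip.continuousOn_B
  exact (hinverse.clm_apply ((hadjoint.clm_apply hgradient).add hD.continuousOn_S)).neg

end Continuity

namespace IsControlledPath

variable {a b : ℝ} {x : Euc n} {X : ℝ → Euc n} {u : ℝ → Euc m}

theorem intervalIntegrable_fderivWithin (hX : D.IsControlledPath a b x X u) (ha : 0 ≤ a)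
    (hb : b ≤ D.T) (hW : ContDiffOn ℝ 1 (fun p : ℝ × Euc n => W p.1 p.2) D.dom) :
    IntervalIntegrable (fun s => fderivWithin ℝ (fun p : ℝ × Euc n => W p.1 p.2) D.dom (s, X s)
      (1, D.velocity s (X s) (u s))) volume a b := by
  have hderiv := hX.continuousOn_comp (f := fun s y => fderivWithin ℝ _ D.dom (s, y)) ha hb
    (hW.continuousOn_fderivWithin D.uniqueDiffOn_dom le_rfl)
  have hvelocity := (intervalIntegrable_iff_integrableOn_Icc_of_le hX.isSolution.le).1
    hX.isSolution.intervalIntegrable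
  refine (intervalIntegrable_iff_integrableOn_Icc_of_le hX.isSolution.le).2
    (memLp_one_iff_integrable.1 (memLp_clm_apply hderiv (memLp_one_iff_integrable.2 ?_)))
  exact (integrable_const 1).prodMk hvelocity

theorem intervalIntegrable_bellman (hX : D.IsControlledPath a b x X u) (hD : D.CoerciveCost)
    (ha : 0 ≤ a) (hb : b ≤ D.T)
    (hW : ContDiffOn ℝ 1 (fun p : ℝ × Euc n => W p.1 p.2) D.dom) :
    IntervalIntegrable (fun s => D.bellman W s (X s) (u s)) volume a b :=
  (hX.intervalIntegrable_fderivWithin ha hb hW).add (hX.intervalIntegrable_running hD ha hb)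

theorem integral_bellman (hX : D.IsControlledPath a b x X u) (hD : D.CoerciveCost)
    (ha : 0 ≤ a) (hb : b ≤ D.T)
    (hW : ContDiffOn ℝ 1 (fun p : ℝ × Euc n => W p.1 p.2) D.dom) :
    ∫ s in a..b, D.bellman W s (X s) (u s) =
      (∫ s in a..b, D.running s (X s) (u s)) + W b (X b) - W a x := by
  have hchain := hX.isSolution.integral_fderivWithin (convex_Icc 0 D.T) (Icc_subset_Icc ha hb) hW
  have hsum := intervalIntegral.integral_add (hX.intervalIntegrable_fderivWithin ha hb hW)
    (hX.intervalIntegrable_running hD ha hb)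
  rw [dom, hchain, hX.isSolution.apply_left] at hsum
  exact hsum.trans (by ring)

end IsControlledPath

variable {t : ℝ} {x : Euc n}

section Localization

open Filter Topology

theorem IsControlledPath.norm_sub_le_of_energy_le {a b N M η s : ℝ} {X : ℝ → Euc n}
    {u : ℝ → Euc m} (hX : D.IsControlledPath a b x X u) (hN : 0 ≤ N)
    (hA : ∀ s ∈ Icc a b, ∀ y, ‖D.A s y‖ ≤ N * (1 + ‖y - x‖))
    (hB : ∀ s ∈ Icc a b, ∀ y, ‖D.B s y‖ ≤ N * (1 + ‖y - x‖))
    (hu : ∫ r in a..b, ‖u r‖ ^ 2 ≤ M) (hη : 0 < η)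
    (hsmall : N * (2 * (b - a) + η * M + (b - a) / η) ≤ 1) (hs : s ∈ Icc a b) :
    ‖X s - x‖ ≤ N * (2 * (b - a) + η * M + (b - a) / η) := by
  have hab := hX.isSolution.le
  have hu1 : IntervalIntegrable (fun r => ‖u r‖) volume a b :=
    (intervalIntegrable_iff_integrableOn_Icc_of_le hab).2 (hX.memLp.integrable one_le_two).norm
  have hφ : IntervalIntegrable (fun r => N * (1 + ‖u r‖)) volume a b :=
    (intervalIntegrable_const.add hu1).const_mul N
  have hvelocity : ∀ r ∈ Icc a b,
      ‖D.velocity r (X r) (u r)‖ ≤ N * (1 + ‖u r‖) * (1 + ‖X r - x‖) := fun r hr =>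
    calc ‖D.velocity r (X r) (u r)‖
        ≤ ‖D.A r (X r)‖ + ‖D.B r (X r)‖ * ‖u r‖ :=
          (norm_add_le _ _).trans (add_le_add_right ((D.B r (X r)).le_opNorm _) _)
      _ ≤ N * (1 + ‖X r - x‖) + N * (1 + ‖X r - x‖) * ‖u r‖ := by
          gcongr
          exacts [hA r hr _, hB r hr _]
      _ = N * (1 + ‖u r‖) * (1 + ‖X r - x‖) := by ring
  have hφ_le : 2 * ∫ r in a..b, N * (1 + ‖u r‖) ≤ N * (2 * (b - a) + η * M + (b - a) / η) := by
    rw [intervalIntegral.integral_const_mul,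
      intervalIntegral.integral_add intervalIntegrable_const hu1, intervalIntegral.integral_const,
      smul_eq_mul, mul_one, mul_left_comm]
    gcongr
    linarith [two_mul_integral_norm_le hab hη hX.memLp, mul_le_mul_of_nonneg_left hu hη.le]
  exact (hX.isSolution.norm_sub_le_two_mul_integral hφ hvelocity (by linarith) hs).trans hφ_le

theorem LipschitzDynamics.eventually_forall_norm_sub_le (hD : D.LipschitzDynamics)
    (ht : t ∈ Ico 0 D.T) (x : Euc n) (M : ℝ) {r : ℝ} (hr : 0 < r) :
    ∀ᶠ δ in 𝓝[>] 0, ∀ X u, D.IsControlledPath t (t + δ) x X u →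
      ∫ s in t..t + δ, ‖u s‖ ^ 2 ≤ M → ∀ s ∈ Icc t (t + δ), ‖X s - x‖ ≤ r := by
  obtain ⟨K, hK⟩ := hD.exists_lipschitzWith
  obtain ⟨NA, hNA, hA⟩ := exists_norm_le_one_add_norm_sub (fun s hs => (hK s hs).1)
    hD.continuousOn_A x
  obtain ⟨NB, hNB, hB⟩ := exists_norm_le_one_add_norm_sub (fun s hs => (hK s hs).2)
    hD.continuousOn_B x
  have hbound : Tendsto (fun δ => (NA + NB) * (2 * δ + √δ * M + √δ)) (𝓝[>] 0) (𝓝 0) := by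
    have hcont : Continuous fun δ => (NA + NB) * (2 * δ + √δ * M + √δ) := by fun_prop
    simpa using (hcont.tendsto 0).mono_left nhdsWithin_le_nhds
  filter_upwards [hbound.eventually_le_const hr, hbound.eventually_le_const one_pos,
    Ioc_mem_nhdsGT (sub_pos.2 ht.2)] with δ hδr hδ1 hδ X u hX hu s hs
  have hsub : Icc t (t + δ) ⊆ Icc 0 D.T := Icc_subset_Icc ht.1 (by linarith [hδ.2])
  have hle := hX.norm_sub_le_of_energy_le (η := √δ) (s := s) (add_nonneg hNA hNB)
    (fun s hs y => (hA s (hsub hs) y).trans (by gcongr; linarith))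
    (fun s hs y => (hB s (hsub hs) y).trans (by gcongr; linarith)) hu (Real.sqrt_pos.2 hδ.1)
  rw [add_sub_cancel_left, Real.div_sqrt] at hle
  exact (hle hδ1 hs).trans hδr

theorem eventually_forall_norm_sub_le_of_cost_le (hLip : D.LipschitzDynamics)
    (hD : D.CoerciveCost) (ht : t ∈ Ico 0 D.T) (x : Euc n) (c : ℝ) {r : ℝ} (hr : 0 < r) :
    ∀ᶠ δ in 𝓝[>] 0, ∀ X u, D.IsControlledPath t D.T x X u → D.cost t X u ≤ c →
      ∀ s ∈ Icc t (t + δ), ‖X s - x‖ ≤ r := by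
  obtain ⟨κ, hκ, C, hC⟩ := hD.exists_le_cost
  filter_upwards [hLip.eventually_forall_norm_sub_le ht x ((c + C) / κ) hr,
    Ioc_mem_nhdsGT (sub_pos.2 ht.2)] with δ hnear hδ X u hX hcost
  have hδT : t + δ ≤ D.T := by linarith [hδ.2]
  have htδ : t ≤ t + δ := le_add_of_nonneg_right hδ.1.le
  have hpath := hX.subinterval le_rfl htδ hδT
  rw [hX.isSolution.apply_left] at hpath
  refine hnear X u hpath ?_
  have hu : IntervalIntegrable (fun s => ‖u s‖ ^ 2) volume t D.T :=
    (intervalIntegrable_iff_integrableOn_Icc_of_le ht.2.le).2 hX.memLp.integrable_norm_pow'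
  calc ∫ s in t..t + δ, ‖u s‖ ^ 2 ≤ ∫ s in t..D.T, ‖u s‖ ^ 2 :=
        intervalIntegral.integral_mono_interval le_rfl htδ hδT
          (Eventually.of_forall fun s => sq_nonneg ‖u s‖) hu
    _ ≤ (c + C) / κ := by
        rw [le_div_iff₀' hκ]
        linarith [hC t ⟨ht.1, ht.2.le⟩ x X u hX]

end Localization

section HamiltonJacobiBellman

theorem bellman_value_nonneg (hLip : D.LipschitzDynamics) (hD : D.CoerciveCost)
    (hV : ContDiffOn ℝ 1 (fun p : ℝ × Euc n => D.value p.1 p.2) D.dom) (ht : t ∈ Icc 0 D.T)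
    (u : Euc m) : 0 ≤ D.bellman D.value t x u := by
  have hcont := continuousOn_bellman hLip hD hV (g := fun _ _ => u) continuousOn_const
  have hbefore : ∀ s ∈ Ico 0 D.T, 0 ≤ D.bellman D.value s x u := by
    intro s hs
    obtain ⟨X, hX⟩ := hLip.exists_isControlledPath_const (Ico_subset_Icc_self hs) x u
    have hleft := nonneg_left_of_integral_nonneg hs.2
      (hX.continuousOn_comp (f := fun s y => D.bellman D.value s y u) hs.1 le_rfl hcont)
      fun c hc => ?_
    · rwa [hX.isSolution.apply_left] at hleft
    · have hXc := hX.subinterval le_rfl hc.1.le hc.2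
      have hdpp := hXc.value_le hLip hD hs.1 hc.2
      rw [hXc.integral_bellman hD hs.1 hc.2 hV]
      linarith
  have hcl := closure_Ico D.T_pos.ne
  refine le_on_closure hbefore continuousOn_const ?_ (hcl.symm ▸ ht)
  rw [hcl]
  exact continuousOn_comp_prodMk (f := fun s y => D.bellman D.value s y u) (X := fun _ => x) hcont
    continuousOn_const

theorem integral_bellman_value_le (hD : D.CoerciveCost)
    (hV : ContDiffOn ℝ 1 (fun p : ℝ × Euc n => D.value p.1 p.2) D.dom) {b : ℝ} {X : ℝ → Euc n}
    {u : ℝ → Euc m} (ht : 0 ≤ t) (htb : t ≤ b) (hb : b ≤ D.T)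
    (hX : D.IsControlledPath t D.T x X u) :
    ∫ s in t..b, D.bellman D.value s (X s) (u s) ≤ D.cost t X u - D.value t x := by
  have hXb := hX.subinterval le_rfl htb hb
  rw [hXb.integral_bellman hD ht hb hV, hX.isSolution.apply_left]
  linarith [hX.integral_add_value_le_cost hD ht htb hb]

open Filter Topology in
/-- If the minimum over `u` were positive at `(t, x)`, it would be bounded below by a positive
constant near `(t, x)`. Nearly optimal paths stay there for a uniform time `δ`, so each of them
would lose an amount proportional to `δ` compared with the value function. -/
theorem bellman_value_feedback_nonpos (hLip : D.LipschitzDynamics) (hD : D.CoerciveCost)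
    (hV : ContDiffOn ℝ 1 (fun p : ℝ × Euc n => D.value p.1 p.2) D.dom) (ht : t ∈ Ico 0 D.T) :
    D.bellman D.value t x (D.feedback D.value t x) ≤ 0 := by
  by_contra! hpos
  obtain ⟨c, hc, hlt⟩ := exists_between hpos
  have hcont := continuousOn_bellman hLip hD hV (continuousOn_feedback hLip hD hV)
  have htx : (t, x) ∈ D.dom := ⟨Ico_subset_Icc_self ht, mem_univ x⟩
  obtain ⟨r, hr, hball⟩ := (nhdsWithin_hasBasis Metric.nhds_basis_closedBall _).eventually_iff.1
    ((hcont (t, x) htx).eventually_const_lt hlt)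
  obtain ⟨δ, hnear, hδ, hδr⟩ :=
    ((eventually_forall_norm_sub_le_of_cost_le hLip hD ht x (D.value t x + 1) hr).and
      (Filter.inter_mem (Ioc_mem_nhdsGT (sub_pos.2 ht.2)) (Ioc_mem_nhdsGT hr))).exists
  have hδT : t + δ ≤ D.T := by linarith [hδ.2]
  have htδ : t ≤ t + δ := le_add_of_nonneg_right hδ.1.le
  obtain ⟨X, u, hX, hcost⟩ := hLip.exists_cost_lt (x := x) (Ico_subset_Icc_self ht)
    (lt_min one_pos (mul_pos hδ.1 hc))
  have hlarge : ∀ s ∈ Icc t (t + δ), c ≤ D.bellman D.value s (X s) (u s) := by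
    intro s hs
    have hsT : s ∈ Icc 0 D.T := ⟨ht.1.trans hs.1, hs.2.trans hδT⟩
    have hXs := hnear X u hX (hcost.le.trans (by gcongr; exact min_le_left _ _)) s hs
    have hst : dist s t ≤ r := by
      rw [Real.dist_eq, abs_of_nonneg (sub_nonneg.2 hs.1)]
      linarith [hs.2, hδr.2]
    have hmem : (s, X s) ∈ Metric.closedBall (t, x) r ∩ D.dom :=
      ⟨max_le hst ((dist_eq_norm _ _).trans_le hXs), hsT, mem_univ _⟩
    exact (hball hmem).le.trans
      (hD.bellman_feedback_le (hV.differentiableOn one_ne_zero) hsT (u s))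
  have hint := (hX.subinterval le_rfl htδ hδT).intervalIntegrable_bellman hD ht.1 hδT hV
  have hlower := intervalIntegral.integral_mono_on htδ intervalIntegrable_const hint hlarge
  rw [intervalIntegral.integral_const, add_sub_cancel_left, smul_eq_mul] at hlower
  linarith [integral_bellman_value_le hD hV ht.1 htδ hδT hX, min_le_right 1 (δ * c)]

theorem bellman_value_feedback (hLip : D.LipschitzDynamics) (hD : D.CoerciveCost)
    (hV : ContDiffOn ℝ 1 (fun p : ℝ × Euc n => D.value p.1 p.2) D.dom) (ht : t ∈ Icc 0 D.T) :
    D.bellman D.value t x (D.feedback D.value t x) = 0 := by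
  refine le_antisymm ?_ (bellman_value_nonneg hLip hD hV ht _)
  have hcl := closure_Ico D.T_pos.ne
  refine le_on_closure (fun s hs => bellman_value_feedback_nonpos hLip hD hV hs) ?_
    continuousOn_const (hcl.symm ▸ ht)
  rw [hcl]
  exact continuousOn_comp_prodMk (X := fun _ => x)
    (f := fun s y => D.bellman D.value s y (D.feedback D.value s y))
    (continuousOn_bellman hLip hD hV (continuousOn_feedback hLip hD hV)) continuousOn_const

/-- The integral of the nonnegative function `D.bellman D.value` along an optimal pair is the cost
minus the value, hence zero. -/
theorem IsOptimalPair.ae_eq_feedback {X : ℝ → Euc n} {u : ℝ → Euc m} (h : D.IsOptimalPair t x X u)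
    (hLip : D.LipschitzDynamics) (hD : D.CoerciveCost)
    (hV : ContDiffOn ℝ 1 (fun p : ℝ × Euc n => D.value p.1 p.2) D.dom) (ht : t ∈ Icc 0 D.T) :
    ∀ᵐ s ∂volume.restrict (Icc t D.T), u s = D.feedback D.value s (X s) := by
  have hX := (isAdmissiblePair_iff ht.2).1 h.1
  have hsub : Icc t D.T ⊆ Icc 0 D.T := Icc_subset_Icc_left ht.1
  have hnonneg : 0 ≤ᵐ[volume.restrict (Icc t D.T)] fun s => D.bellman D.value s (X s) (u s) := by
    filter_upwards [ae_restrict_mem measurableSet_Icc] with s hs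
    exact bellman_value_nonneg hLip hD hV (hsub hs) (u s)
  have hint := (intervalIntegrable_iff_integrableOn_Icc_of_le ht.2).1
    (hX.intervalIntegrable_bellman hD ht.1 le_rfl hV)
  have hintegral : ∫ s in Icc t D.T, D.bellman D.value s (X s) (u s) = 0 := by
    refine le_antisymm ?_ (integral_nonneg_of_ae hnonneg)
    rw [integral_Icc_eq_integral_Ioc, ← intervalIntegral.integral_of_le ht.2]
    exact (integral_bellman_value_le hD hV ht.1 ht.2 le_rfl hX).trans_eq (sub_eq_zero.2 h.2)
  obtain ⟨c, hc, hcoercive⟩ := hD.exists_le_inner_R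
  filter_upwards [(setIntegral_eq_zero_iff_of_nonneg_ae hnonneg hint).1 hintegral,
    ae_restrict_mem measurableSet_Icc] with s hzero hs
  rw [hD.bellman_eq_bellman_feedback_add (hV.differentiableOn one_ne_zero) (hsub hs) (u s),
    bellman_value_feedback hLip hD hV (hsub hs), zero_add, Pi.zero_apply] at hzero
  have hle := hcoercive s (hsub hs) (X s) (u s - D.feedback D.value s (X s))
  have hsq : ‖u s - D.feedback D.value s (X s)‖ ^ 2 ≤ 0 :=
    nonpos_of_mul_nonpos_right (by linarith) hc
  simpa [sub_eq_zero] using hsq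

end HamiltonJacobiBellman

section TwiceDifferentiable

theorem TwiceDifferentiable.contDiffOn (hW : D.TwiceDifferentiable W) :
    ContDiffOn ℝ 1 (fun p : ℝ × Euc n => W p.1 p.2) D.dom :=
  (contDiffOn_succ_iff_fderivWithin (n := 0) D.uniqueDiffOn_dom).2
    ⟨hW.1, by simp, contDiffOn_zero.2 hW.2.continuousOn⟩

theorem TwiceDifferentiable.second_derivative_symm (hW : D.TwiceDifferentiable W)
    {p : ℝ × Euc n} (hp : p ∈ D.dom) (v w : ℝ × Euc n) :
    fderivWithin ℝ (fderivWithin ℝ (fun p : ℝ × Euc n => W p.1 p.2) D.dom) D.dom p v w =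
      fderivWithin ℝ (fderivWithin ℝ (fun p : ℝ × Euc n => W p.1 p.2) D.dom) D.dom p w v := by
  have hconvex : Convex ℝ D.dom := (convex_Icc 0 D.T).prod convex_univ
  have hinterior : (interior D.dom).Nonempty := by
    rw [dom, interior_prod_eq, interior_Icc, interior_univ, prod_nonempty_iff, nonempty_Ioo]
    exact ⟨D.T_pos, univ_nonempty⟩
  exact hconvex.second_derivative_within_at_symmetric hinterior
    (fun q hq => (hW.1 q (interior_subset hq)).hasFDerivWithinAt.hasFDerivAt
      (mem_interior_iff_mem_nhds.1 hq)) hp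
    ((hW.2 p hp).hasFDerivWithinAt.mono interior_subset) v w

theorem TwiceDifferentiable.hasFDerivWithinAt_gradient (hW : D.TwiceDifferentiable W)
    {p : ℝ × Euc n} (hp : p ∈ D.dom) :
    HasFDerivWithinAt (fun p : ℝ × Euc n => gradient (W p.1) p.2)
      (stateGradient (Euc n) ∘L
        fderivWithin ℝ (fderivWithin ℝ (fun p : ℝ × Euc n => W p.1 p.2) D.dom) D.dom p)
      D.dom p :=
  ((stateGradient (Euc n)).hasFDerivAt.comp_hasFDerivWithinAt p
    (hW.2 p hp).hasFDerivWithinAt).congr (fun _ hq => gradient_eq_stateGradient hW.1 hq)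
      (gradient_eq_stateGradient hW.1 hp)

theorem TwiceDifferentiable.fderivWithin_fderivWithin_apply (hW : D.TwiceDifferentiable W)
    (ht : t ∈ Icc 0 D.T) (v y : Euc n) :
    fderivWithin ℝ (fderivWithin ℝ (fun p : ℝ × Euc n => W p.1 p.2) D.dom) D.dom (t, x) (0, y)
        (1, v) =
      inner ℝ (derivWithin (fun s => gradient (W s) x) (Icc 0 D.T) t +
        fderiv ℝ (fun z => gradient (W t) z) x v) y := by
  have hp : (t, x) ∈ D.dom := ⟨ht, mem_univ x⟩
  have hgrad := hW.hasFDerivWithinAt_gradient hp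
  rw [(hasDerivWithinAt_slice hgrad).derivWithin (uniqueDiffOn_Icc D.T_pos t ht),
    (hasFDerivAt_slice ht hgrad).fderiv, ContinuousLinearMap.comp_apply _ (.inr ℝ ℝ (Euc n)),
    ← map_add, ContinuousLinearMap.inr_apply, Prod.mk_add_mk, add_zero, zero_add,
    ContinuousLinearMap.comp_apply, inner_stateGradient, hW.second_derivative_symm hp]

theorem TwiceDifferentiable.hasFDerivAt_bellman (hW : D.TwiceDifferentiable W)
    (ht : t ∈ Icc 0 D.T) (hA : DifferentiableAt ℝ (D.A t) x) (hQ : DifferentiableAt ℝ (D.Q t) x)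
    (hS : DifferentiableAt ℝ (D.S t) x) {B₀ : Euc m →L[ℝ] Euc n} (hB : ∀ y, D.B t y = B₀)
    {R₀ : Euc m →L[ℝ] Euc m} (hR : ∀ y, D.R t y = R₀) (u : Euc m) :
    HasFDerivAt (fun y => D.bellman W t y u)
      (InnerProductSpace.toDual ℝ (Euc n)
        (derivWithin (fun s => gradient (W s) x) (Icc 0 D.T) t
          + fderiv ℝ (fun z => gradient (W t) z) x (D.A t x + B₀ u)
          + ContinuousLinearMap.adjoint (fderiv ℝ (D.A t) x) (gradient (W t) x)
          + gradient (D.Q t) x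
          + ContinuousLinearMap.adjoint (fderiv ℝ (D.S t) x) u)) x := by
  have hp : (t, x) ∈ D.dom := ⟨ht, mem_univ x⟩
  have hDW := hasFDerivAt_slice ht (hW.2 (t, x) hp).hasFDerivWithinAt
  have hvelocity : HasFDerivAt (fun y => ((1 : ℝ), D.velocity t y u))
      (ContinuousLinearMap.inr ℝ ℝ (Euc n) ∘L fderiv ℝ (D.A t) x) x := by
    simp only [velocity, hB]
    exact (hasFDerivAt_prodMk_right (1 : ℝ) _).comp x (hA.hasFDerivAt.add_const (B₀ u))
  have hrunning : HasFDerivAt (fun y => D.running t y u)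
      (fderiv ℝ (D.Q t) x + innerSL ℝ u ∘L fderiv ℝ (D.S t) x) x := by
    simp only [running, hR, real_inner_comm u (D.S t _)]
    exact (hQ.hasFDerivAt.add ((innerSL ℝ u).hasFDerivAt.comp x hS.hasFDerivAt)).add_const _
  refine ((hDW.clm_apply hvelocity).add hrunning).congr_fderiv ?_
  ext y
  have hstate : fderivWithin ℝ (fun p : ℝ × Euc n => W p.1 p.2) D.dom (t, x)
      (0, fderiv ℝ (D.A t) x y) = inner ℝ (gradient (W t) x) (fderiv ℝ (D.A t) x y) := by
    rw [gradient_eq_stateGradient hW.1 hp, inner_stateGradient]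
  have hmixed := hW.fderivWithin_fderivWithin_apply ht (D.velocity t x u) y (x := x)
  rw [velocity, hB] at hmixed
  simp only [add_apply, ContinuousLinearMap.comp_apply,
    ContinuousLinearMap.flip_apply, ContinuousLinearMap.inr_apply, innerSL_apply_apply,
    InnerProductSpace.toDual_apply_apply, velocity, hB, hstate, hmixed, inner_add_left,
    ContinuousLinearMap.adjoint_inner_left, inner_gradient_left (f := D.Q t)]
  ring

end TwiceDifferentiable

open Filter in
/-- The nonnegative function `y ↦ D.bellman D.value t y u` with `u` the feedback control at `(t, x)`
vanishes at `x`, so its derivative there is zero; no derivative of the feedback is involved. -/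
theorem quasiRiccati_of_value (hLip : D.LipschitzDynamics) (hD : D.CoerciveCost)
    (hV : D.TwiceDifferentiable D.value) (ht : t ∈ Icc 0 D.T)
    (hA : DifferentiableAt ℝ (D.A t) x) (hQ : DifferentiableAt ℝ (D.Q t) x)
    (hS : DifferentiableAt ℝ (D.S t) x) {B₀ : Euc m →L[ℝ] Euc n} (hB : ∀ y, D.B t y = B₀)
    {R₀ : Euc m →L[ℝ] Euc m} (hR : ∀ y, D.R t y = R₀) :
    derivWithin (fun s => gradient (D.value s) x) (Icc 0 D.T) t
      + fderiv ℝ (fun z => gradient (D.value t) z) x (D.A t x)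
      + ContinuousLinearMap.adjoint (fderiv ℝ (D.A t) x) (gradient (D.value t) x)
      + gradient (D.Q t) x
      - (fderiv ℝ (fun z => gradient (D.value t) z) x ∘L B₀
          + ContinuousLinearMap.adjoint (fderiv ℝ (D.S t) x))
        (R₀.inverse (ContinuousLinearMap.adjoint B₀ (gradient (D.value t) x) + D.S t x)) = 0 := by
  have hmin : IsLocalMin (fun y => D.bellman D.value t y (D.feedback D.value t x)) x := by
    refine Eventually.of_forall fun y => ?_
    exact (bellman_value_feedback hLip hD hV.contDiffOn ht).trans_le
      (bellman_value_nonneg hLip hD hV.contDiffOn ht _)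
  have hzero := (map_eq_zero_iff _ (InnerProductSpace.toDual ℝ (Euc n)).injective).1
    (hmin.hasFDerivAt_eq_zero
      (hV.hasFDerivAt_bellman ht hA hQ hS hB hR (D.feedback D.value t x)))
  rw [← hzero, feedback, hB, hR]
  simp only [add_apply, ContinuousLinearMap.comp_apply, map_neg, map_add]
  abel

theorem solvesQuasiRiccati_gradient_value (hLip : D.LipschitzDynamics) (hD : D.CoerciveCost)
    (hA : ∀ t ∈ Icc 0 D.T, Differentiable ℝ (D.A t))
    (hQ : ∀ t ∈ Icc 0 D.T, Differentiable ℝ (D.Q t))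
    (hS : ∀ t ∈ Icc 0 D.T, Differentiable ℝ (D.S t))
    {B₀ : ℝ → (Euc m →L[ℝ] Euc n)} {R₀ : ℝ → (Euc m →L[ℝ] Euc m)}
    (hB : ∀ t ∈ Icc 0 D.T, ∀ x, D.B t x = B₀ t) (hR : ∀ t ∈ Icc 0 D.T, ∀ x, D.R t x = R₀ t)
    (hV : D.TwiceDifferentiable D.value) :
    D.SolvesQuasiRiccati B₀ R₀ fun t x => gradient (D.value t) x :=
  ⟨fun _ hp => (hV.hasFDerivWithinAt_gradient hp).differentiableWithinAt,
    fun t ht x => quasiRiccati_of_value hLip hD hV ht (hA t ht x) (hQ t ht x) (hS t ht x)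
      (hB t ht) (hR t ht),
    fun _ => congrArg (gradient · _) (funext hLip.value_terminal)⟩

end AQProblem

theorem proposition6p1_general {n m : ℕ} (D : AQProblem n m)
    (hLip : D.LipschitzDynamics) (hD : D.CoerciveCost)
    (hA : ∀ t ∈ Icc 0 D.T, Differentiable ℝ (D.A t))
    (hQ : ∀ t ∈ Icc 0 D.T, Differentiable ℝ (D.Q t))
    (hS : ∀ t ∈ Icc 0 D.T, Differentiable ℝ (D.S t))
    (B₀ : ℝ → (Euc m →L[ℝ] Euc n)) (R₀ : ℝ → (Euc m →L[ℝ] Euc m))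
    (hB : ∀ t ∈ Icc 0 D.T, ∀ x : Euc n, D.B t x = B₀ t)
    (hR : ∀ t ∈ Icc 0 D.T, ∀ x : Euc n, D.R t x = R₀ t)
    (hV : D.TwiceDifferentiable D.value)
    (P : ℝ → Euc n → Euc n) (hP : ∀ t x, P t x = gradient (D.value t) x) :
    D.SolvesQuasiRiccati B₀ R₀ P ∧
    ∀ t ∈ Icc 0 D.T, ∀ (x : Euc n) (X : ℝ → Euc n) (u : ℝ → Euc m),
      D.IsOptimalPair t x X u →
      ∀ᵐ s ∂(volume.restrict (Icc t D.T)),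
        u s = -(R₀ s).inverse
          (ContinuousLinearMap.adjoint (B₀ s) (P s (X s)) + D.S s (X s)) := by
  obtain rfl : P = fun t x => gradient (D.value t) x := funext₂ hP
  refine ⟨AQProblem.solvesQuasiRiccati_gradient_value hLip hD hA hQ hS hB hR hV,
    fun t ht x X u hXu => ?_⟩
  filter_upwards [hXu.ae_eq_feedback hLip hD hV.contDiffOn ht,
    ae_restrict_mem measurableSet_Icc] with s hu hs
  have hsT : s ∈ Icc 0 D.T := ⟨ht.1.trans hs.1, hs.2⟩
  rw [hu, AQProblem.feedback, hB s hsT, hR s hsT]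

theorem proposition6p1 {n m : ℕ} (D : AQProblem n m)
    (h1 : D.H1) (h2 : D.H2) (h3 : D.H3)
    (B₀ : ℝ → (Euc m →L[ℝ] Euc n)) (R₀ : ℝ → (Euc m →L[ℝ] Euc m))
    (hB : ∀ t ∈ Set.Icc 0 D.T, ∀ x : Euc n, D.B t x = B₀ t)
    (hR : ∀ t ∈ Set.Icc 0 D.T, ∀ x : Euc n, D.R t x = R₀ t)
    (hV : D.TwiceDifferentiable D.value)
    (P : ℝ → Euc n → Euc n) (hP : ∀ t x, P t x = gradient (D.value t) x) :
    D.SolvesQuasiRiccati B₀ R₀ P ∧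
    ∀ t ∈ Set.Icc 0 D.T, ∀ (x : Euc n) (X : ℝ → Euc n) (u : ℝ → Euc m),
      D.IsOptimalPair t x X u →
      ∀ᵐ s ∂(MeasureTheory.volume.restrict (Set.Icc t D.T)),
        u s = -(R₀ s).inverse
          (ContinuousLinearMap.adjoint (B₀ s) (P s (X s)) + D.S s (X s)) :=
  proposition6p1_general D h1.lipschitzDynamics h2.coerciveCost
    (fun _ => differentiable_slice (h3.1.differentiableOn two_ne_zero))
    (fun _ => differentiable_slice (h3.2.2.1.differentiableOn two_ne_zero))
    (fun _ => differentiable_slice (h3.2.2.2.1.differentiableOn two_ne_zero)) B₀ R₀ hB hR hV P hP
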